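/- All vector spaces are real and all vector lattices are Archimedean. An \emph{$f$-algebra} is a vector lattice $\mathcal A$ with an associative bilinear multiplication such that $a,b\geq 0$ implies $ab\geq 0$, and such that $a\wedge b=0$ and $c\geq 0$ imply $(ca)\wedge b=(ac)\wedge b=0$. An element $e\geq 0$ of a vector lattice $\mathcal A$ is an \emph{order unit} if for every $a\in\mathcal A$ there is a $\lambda\geq 0$ with $|a|\leq\lambda e$; the corresponding order unit norm is $\|a\|_e=\inf\{\lambda\geq 0: |a|\leq\lambda e\}$. A \emph{Banach $f$-subalgebra} of an $f$-algebra whose identity $e$ is an order unit is a (not necessarily unital) subalgebra that is also a vector sublattice, that is complete in $\|\cdot\|_e$, and on which $\|\cdot\|_e$ is a submultiplicative lattice norm. \textbf{Theorem.} Let $\mathcal A$ be a unital $f$-algebra such that its identity element $e$ is also a (positive) order unit, and such that $\mathcal A$ is complete in the order unit norm $\|\cdot\|_e$. Let $\mathcal B$ be a (not necessarily unital) associative subalgebra of $\mathcal A$, and let $\overline{\mathcal B}$ be its closure in the norm $\|\cdot\|_e$. Then $\overline{\mathcal B}$ is a Banach $f$-subalgebra of $\mathcal A$. When $e\in\overline{\mathcal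 B}$, there exist a compact Hausdorff space $K$, uniquely determined up to homeomorphism, and a surjective isometric Banach lattice algebra isomorphism $\psi:\overline{\mathcal B}\to C(K)$ (that is, a bijective linear map that preserves products, suprema, infima, and the norm), where $C(K)$ is the space of real-valued continuous functions on $K$ with the supremum norm. In particular, this applies to $\mathcal A=\mathrm{Orth}(E)$ and $e=I$ for every Banach lattice $E$, where $\mathrm{Orth}(E)$ is the algebra of all linear operators $T:E\to E$ that are order bounded and that leave every band of $E$ invariant: in the ordering in which $S\leq T$ if and only if $Sx\leq Tx$ for all $x\geq 0$ in $E$, $\mathrm{Orth}(E)$ is a unital $f$-algebra with the identity operator $I$ as order unit; every $T\in\mathrm{Orth}(E)$ is bounded, and its operator norm is equal to $\|T\|_I$; and $\mathrm{Orth}(E)$ is complete in this norm. Consequently, the above conclusions hold for every subalgebra $\mathcal B$ of $\mathrm{Orth}(E)$. -/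

import Mathlib

universe u v w

/-- An Archimedean real vector lattice: the order is compatible with addition and with
multiplication by non-negative scalars, and `n • x ≤ y` for all `n` forces `x ≤ 0`. -/
class IsArchimedeanVectorLattice (V : Type*) [AddCommGroup V] [Module ℝ V] [Lattice V] : Prop
    extends IsOrderedAddMonoid V, IsOrderedModule ℝ V where
  archimedean : ∀ x y : V, (∀ n : ℕ, n • x ≤ y) → x ≤ 0

/-- An (associative, unital, Archimedean) f-algebra: a vector lattice with a multiplication for
which products of positive elements are positive, and such that `a ⊓ b = 0` and `0 ≤ c` imply
`(c * a) ⊓ b = (a * c) ⊓ b = 0`. Commutativity is not assumed. -/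
class IsFAlgebra (A : Type*) [Ring A] [Algebra ℝ A] [Lattice A] : Prop
    extends IsArchimedeanVectorLattice A where
  mul_nonneg : ∀ a b : A, 0 ≤ a → 0 ≤ b → 0 ≤ a * b
  mul_left_inf : ∀ a b c : A, a ⊓ b = 0 → 0 ≤ c → (c * a) ⊓ b = 0
  mul_right_inf : ∀ a b c : A, a ⊓ b = 0 → 0 ≤ c → (a * c) ⊓ b = 0

section OrderUnit

variable {V : Type*} [AddCommGroup V] [Module ℝ V] [Lattice V]

/-- `e` is a (positive) order unit. -/
def IsOrderUnit (e : V) : Prop :=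
  0 ≤ e ∧ ∀ x : V, ∃ r : ℝ, 0 ≤ r ∧ |x| ≤ r • e

/-- The order unit norm `‖x‖_e = inf {r ≥ 0 : |x| ≤ r e}`. -/
noncomputable def orderUnitNorm (e x : V) : ℝ :=
  sInf {r : ℝ | 0 ≤ r ∧ |x| ≤ r • e}

theorem orderUnitNorm_nonneg (e x : V) : 0 ≤ orderUnitNorm e x :=
  Real.sInf_nonneg fun _ hr => hr.1

theorem orderUnitNorm_le {e x : V} {r : ℝ} (hr : 0 ≤ r) (h : |x| ≤ r • e) :
    orderUnitNorm e x ≤ r :=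
  csInf_le ⟨0, fun _ hs => hs.1⟩ ⟨hr, h⟩

theorem IsOrderUnit.exists_lt {e : V} (he : IsOrderUnit e) (x : V) {s : ℝ}
    (hs : orderUnitNorm e x < s) : ∃ r : ℝ, 0 ≤ r ∧ r < s ∧ |x| ≤ r • e := by
  obtain ⟨r, hr, hrs⟩ := exists_lt_of_csInf_lt (he.2 x) hs
  exact ⟨r, hr.1, hrs, hr.2⟩

variable [IsArchimedeanVectorLattice V]

theorem IsOrderUnit.eq_zero {e : V} (he : IsOrderUnit e) {x : V} (h : orderUnitNorm e x = 0) :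
    x = 0 := by
  have key : |x| ≤ 0 := by
    refine IsArchimedeanVectorLattice.archimedean |x| e fun n => ?_
    obtain ⟨r, hr0, hr, hx⟩ := he.exists_lt x (s := 1 / ((n : ℝ) + 1)) (by rw [h]; positivity)
    have h1 : (n : ℝ) * r ≤ 1 := by
      have h2 : ((n : ℝ) + 1) * r ≤ 1 := by
        rw [lt_div_iff₀ (by positivity)] at hr
        linarith
      nlinarith
    calc n • |x| = (n : ℝ) • |x| := (Nat.cast_smul_eq_nsmul ℝ n _).symm
      _ ≤ (n : ℝ) • (r • e) := smul_le_smul_of_nonneg_left hx (by positivity)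
      _ = ((n : ℝ) * r) • e := smul_smul _ _ _
      _ ≤ (1 : ℝ) • e := smul_le_smul_of_nonneg_right h1 he.1
      _ = e := one_smul _ _
  have h1 : x ≤ 0 := (le_abs_self x).trans key
  have h2 : -x ≤ 0 := (neg_le_abs x).trans key
  exact le_antisymm h1 (neg_nonpos.mp h2)

/-- The order unit norm of an order unit of an Archimedean vector lattice is a norm; this is the
resulting normed group structure. -/
noncomputable abbrev IsOrderUnit.normedAddCommGroup {e : V} (he : IsOrderUnit e) :
    NormedAddCommGroup V :=
  AddGroupNorm.toNormedAddCommGroup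
    { toFun := orderUnitNorm e
      map_zero' := le_antisymm (orderUnitNorm_le le_rfl (by simp)) (orderUnitNorm_nonneg e 0)
      add_le' := fun x y => by
        refine le_of_forall_pos_le_add fun ε hε => ?_
        obtain ⟨r, hr0, hr, hx⟩ := he.exists_lt x
          (lt_add_of_pos_right (orderUnitNorm e x) (half_pos hε))
        obtain ⟨s, hs0, hs, hy⟩ := he.exists_lt y
          (lt_add_of_pos_right (orderUnitNorm e y) (half_pos hε))
        have h : orderUnitNorm e (x + y) ≤ r + s := by
          refine orderUnitNorm_le (add_nonneg hr0 hs0) ?_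
          rw [add_smul]
          exact (abs_add_le x y).trans (add_le_add hx hy)
        linarith
      neg' := fun x => by simp [orderUnitNorm]
      eq_zero_of_map_eq_zero' := fun _ h => he.eq_zero h }

end OrderUnit

section Subalgebras

variable {A : Type*} [Ring A] [Algebra ℝ A] [Lattice A]

/-- The subalgebra `C` of the f-algebra `A` is a Banach f-subalgebra in the order unit norm of the
identity: it is a vector sublattice (so that it is an f-algebra itself), the norm is a lattice norm
and submultiplicative on it, and it is complete. -/
structure IsBanachFSubalgebra [IsFAlgebra A] (hu : IsOrderUnit (1 : A))
    (C : NonUnitalSubalgebra ℝ A) : Prop where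
  sup_mem : ∀ a ∈ C, ∀ b ∈ C, a ⊔ b ∈ C
  inf_mem : ∀ a ∈ C, ∀ b ∈ C, a ⊓ b ∈ C
  norm_solid : ∀ a ∈ C, ∀ b ∈ C, |a| ≤ |b| → orderUnitNorm 1 a ≤ orderUnitNorm 1 b
  norm_mul_le : ∀ a ∈ C, ∀ b ∈ C,
    orderUnitNorm 1 (a * b) ≤ orderUnitNorm 1 a * orderUnitNorm 1 b
  complete : letI := hu.normedAddCommGroup; IsComplete (C : Set A)

/-- `C`, with the operations, the order and the order unit norm (of the identity) of `A`, is
isometrically isomorphic to `C(K, ℝ)` as a Banach lattice algebra. -/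
def IsIsometricallyContinuousFunctions (C : NonUnitalSubalgebra ℝ A) (K : Type*)
    [TopologicalSpace K] [CompactSpace K] : Prop :=
  ∃ ψ : C →ₙₐ[ℝ] C(K, ℝ), Function.Bijective ψ ∧
    (∀ a b c : C, (c : A) = (a : A) ⊔ (b : A) → ψ c = ψ a ⊔ ψ b) ∧
    (∀ a b c : C, (c : A) = (a : A) ⊓ (b : A) → ψ c = ψ a ⊓ ψ b) ∧
    ∀ a : C, ‖ψ a‖ = orderUnitNorm 1 (a : A)

end Subalgebras

section Orthomorphisms

variable (E : Type*) [AddCommGroup E] [Module ℝ E] [Lattice E]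

/-- A band: a solid linear subspace (that is, an ideal) that contains every supremum in `E` of a
subset of itself. -/
structure IsBand {E : Type*} [AddCommGroup E] [Module ℝ E] [Lattice E] (S : Submodule ℝ E) :
    Prop where
  solid : LatticeOrderedAddCommGroup.IsSolid (S : Set E)
  mem_of_isLUB : ∀ D : Set E, D ⊆ S → ∀ x : E, IsLUB D x → x ∈ S

variable [IsOrderedAddMonoid E] [IsOrderedModule ℝ E]

/-- The unital algebra `Orth(E)` of orthomorphisms of `E`: the linear maps from `E` to `E` that are
band preserving and order bounded. -/
def Orth : Subalgebra ℝ (Module.End ℝ E) where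
  carrier := {T | (∀ S : Submodule ℝ E, IsBand S → ∀ x ∈ S, T x ∈ S) ∧
    ∀ a b : E, ∃ c d : E, ∀ x ∈ Set.Icc a b, T x ∈ Set.Icc c d}
  mul_mem' := by
    rintro T U ⟨hT, hT'⟩ ⟨hU, hU'⟩
    refine ⟨fun S hS x hx => hT S hS _ (hU S hS x hx), fun a b => ?_⟩
    obtain ⟨c, d, h⟩ := hU' a b
    obtain ⟨c', d', h'⟩ := hT' c d
    exact ⟨c', d', fun x hx => h' _ (h x hx)⟩
  add_mem' := by
    rintro T U ⟨hT, hT'⟩ ⟨hU, hU'⟩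
    refine ⟨fun S hS x hx => S.add_mem (hT S hS x hx) (hU S hS x hx), fun a b => ?_⟩
    obtain ⟨c, d, h⟩ := hT' a b
    obtain ⟨c', d', h'⟩ := hU' a b
    exact ⟨c + c', d + d', fun x hx =>
      ⟨add_le_add (h x hx).1 (h' x hx).1, add_le_add (h x hx).2 (h' x hx).2⟩⟩
  algebraMap_mem' := by
    intro r
    refine ⟨fun S _ x hx => S.smul_mem r hx, fun a b => ?_⟩
    rcases le_total 0 r with hr | hr
    · exact ⟨r • a, r • b, fun x hx =>
        ⟨smul_le_smul_of_nonneg_left hx.1 hr, smul_le_smul_of_nonneg_left hx.2 hr⟩⟩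
    · exact ⟨r • b, r • a, fun x hx =>
        ⟨smul_le_smul_of_nonpos_left hx.2 hr, smul_le_smul_of_nonpos_left hx.1 hr⟩⟩

end Orthomorphisms

/-! The general statement rests on the unital multiplicative lattice homomorphisms `φ : A → ℝ`
(characters): the order unit norm of `a` is the largest value of `|φ a|`. Hahn–Banach gives a
positive functional, normalized at `1`, that attains the norm of `|a|`. All such functionals form a
nonempty compact face of the set of states, so by Krein–Milman this face contains an extreme state.
Extreme states are multiplicative: for `0 ≤ c ≤ 1` the state is a convex combination of the
normalizations of `φ (c * ·)` and `φ ((1 - c) * ·)`. Since `|a| * |a| = a * a`, multiplicative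
states preserve absolute values.

Norm inequalities can thus be checked on real numbers. In this way `|a|` is a norm limit of
polynomials in `a` without constant term, so closed subalgebras are sublattices. If such a
subalgebra contains `1`, Stone–Weierstrass identifies it with the continuous functions on the
restricted characters, and `K` is recovered as the character space of `C(K, ℝ)`.

For orthomorphisms everything follows from `Orth.abs_le_abs`: `|y| ≤ u` implies `|T y| ≤ |T u|`.
Where `y` is close to `t • u` with `|t| ≤ 1`, `T y` is close to `t • T u`; finitely many such
regions exhaust everything. Consequently `x ↦ |T x|` is additive on the positive cone and extends to
a modulus of `T`, and the lattice operations are pointwise on that cone. Finally `|T| ≤ ‖T‖ • 1`,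
because for `r > ‖T‖` the powers of `|T|` grow too slowly for `(|T| - r • 1)⁺` to be nonzero. -/

section VectorLattice

/-! ### Disjointness and bands in vector lattices -/

section Group

variable {E : Type*} [AddCommGroup E] [Lattice E]

theorem inf_eq_zero_of_le {a b q : E} (ha : 0 ≤ a) (hq : 0 ≤ q) (hab : a ≤ b) (h : b ⊓ q = 0) :
    a ⊓ q = 0 :=
  le_antisymm (h ▸ inf_le_inf_right q hab) (le_inf ha hq)

variable [IsOrderedAddMonoid E]

theorem add_inf_eq_zero {a b q : E} (ha : 0 ≤ a) (hb : 0 ≤ b) (hq : 0 ≤ q) (h : a ⊓ q = 0)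
    (h' : b ⊓ q = 0) : (a + b) ⊓ q = 0 := by
  refine le_antisymm ?_ (le_inf (add_nonneg ha hb) hq)
  -- The left side lies below both `a` and `q`; hence `(a + b) ⊓ q` lies below `b` as well as `q`.
  have h1 : (a + b) ⊓ q - b ≤ 0 := h ▸ le_inf (sub_le_iff_le_add.mpr inf_le_left)
    ((sub_le_self _ hb).trans inf_le_right)
  exact h' ▸ le_inf (sub_nonpos.mp h1) inf_le_right

theorem abs_eq_self_add_two_negPart (a : E) : |a| = a + (a⁻ + a⁻) := by
  rw [← posPart_add_negPart]
  nth_rewrite 3 [← posPart_sub_negPart a]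
  abel

/-- Both sides are the supremum of the four elements `±a ± b`. -/
theorem abs_add_abs_eq_sup (a b : E) : |a| + |b| = |a + b| ⊔ |a - b| := by
  simp only [abs, sup_add, add_sup, neg_add, sub_eq_add_neg, neg_neg]
  ac_rfl

/-- The part of `b` cut off outside `[-c, c]` is disjoint from the set where `|b| < c`. -/
theorem abs_sub_truncation_inf_eq_zero (b c : E) :
    |b - ((b ⊓ c) ⊔ (-c))| ⊓ (c - |b|)⁺ = 0 := by
  refine inf_eq_zero_of_le (abs_nonneg _) (posPart_nonneg _)
    (?_ : _ ≤ (c - |b|)⁻) (by rw [inf_comm]; exact posPart_inf_negPart_eq_zero _)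
  have h1 : |b| - c ≤ (c - |b|)⁻ := by
    rw [← neg_sub c |b|]; exact neg_le_negPart _
  have h0 : 0 ≤ (c - |b|)⁻ := negPart_nonneg _
  refine abs_le'.mpr ⟨?_, ?_⟩
  · calc b - ((b ⊓ c) ⊔ (-c)) ≤ b - b ⊓ c := sub_le_sub_left le_sup_left _
      _ = 0 ⊔ (b - c) := by rw [sub_inf, sub_self]
      _ ≤ _ := sup_le h0 ((sub_le_sub_right (le_abs_self b) c).trans h1)
  · rw [neg_sub, sup_sub]
    refine sup_le ((sub_nonpos.mpr inf_le_left).trans h0) ?_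
    refine le_trans ?_ h1
    rw [sub_eq_add_neg, add_comm, ← sub_eq_add_neg]
    exact sub_le_sub_right (neg_le_abs b) c

end Group

variable {E : Type*} [AddCommGroup E] [Module ℝ E] [Lattice E]

theorem smul_inf_eq_zero [IsOrderedAddMonoid E] [IsOrderedModule ℝ E] {a q : E} {r : ℝ}
    (hr : 0 ≤ r) (ha : 0 ≤ a) (hq : 0 ≤ q)
    (h : a ⊓ q = 0) : (r • a) ⊓ q = 0 := by
  refine le_antisymm ?_ (le_inf (smul_nonneg hr ha) hq)
  -- Dividing by `r + 1` rather than `r` covers `r = 0`, and makes both `r / (r + 1)` and `1 / (r +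
  -- 1)` at most `1`.
  have hs : 0 < r + 1 := by positivity
  have h0 : 0 ≤ (r • a) ⊓ q := le_inf (smul_nonneg hr ha) hq
  have h1 : (r + 1)⁻¹ • ((r • a) ⊓ q) ≤ 0 := by
    rw [← h]
    refine le_inf ?_ ?_
    · calc (r + 1)⁻¹ • ((r • a) ⊓ q) ≤ (r + 1)⁻¹ • (r • a) :=
            smul_le_smul_of_nonneg_left inf_le_left (by positivity)
        _ = ((r + 1)⁻¹ * r) • a := smul_smul _ _ _
        _ ≤ (1 : ℝ) • a := smul_le_smul_of_nonneg_right
            (by rw [inv_mul_le_iff₀ hs]; linarith) ha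
        _ = a := one_smul _ _
    · calc (r + 1)⁻¹ • ((r • a) ⊓ q) ≤ (1 : ℝ) • ((r • a) ⊓ q) :=
            smul_le_smul_of_nonneg_right (inv_le_one_of_one_le₀ (by linarith)) h0
        _ ≤ q := by rw [one_smul]; exact inf_le_right
  calc (r • a) ⊓ q = (r + 1) • ((r + 1)⁻¹ • ((r • a) ⊓ q)) := by
        rw [smul_smul, mul_inv_cancel₀ hs.ne', one_smul]
    _ ≤ (r + 1) • (0 : E) := smul_le_smul_of_nonneg_left h1 hs.le
    _ = 0 := smul_zero _

theorem abs_smul_of_nonneg [IsOrderedAddMonoid E] [IsOrderedModule ℝ E] {r : ℝ} (hr : 0 ≤ r)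
    (a : E) : |r • a| = r • |a| := by
  rcases hr.eq_or_lt with rfl | hr'
  · simp
  refine le_antisymm (abs_le'.mpr ⟨smul_le_smul_of_nonneg_left (le_abs_self a) hr, ?_⟩) ?_
  · rw [← smul_neg]; exact smul_le_smul_of_nonneg_left (neg_le_abs a) hr
  · have h : |a| ≤ r⁻¹ • |r • a| := by
      have h2 : a = r⁻¹ • (r • a) := by rw [smul_smul, inv_mul_cancel₀ hr'.ne', one_smul]
      refine abs_le'.mpr ⟨?_, ?_⟩
      · nth_rewrite 1 [h2]
        exact smul_le_smul_of_nonneg_left (le_abs_self _) (by positivity)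
      · nth_rewrite 1 [h2]
        rw [← smul_neg]
        exact smul_le_smul_of_nonneg_left (neg_le_abs _) (by positivity)
    calc r • |a| ≤ r • (r⁻¹ • |r • a|) := smul_le_smul_of_nonneg_left h hr
      _ = |r • a| := by rw [smul_smul, mul_inv_cancel₀ hr'.ne', one_smul]

theorem abs_smul_eq [IsOrderedAddMonoid E] [IsOrderedModule ℝ E] (r : ℝ)
    (a : E) : |r • a| = |r| • |a| := by
  rcases le_total 0 r with h | h
  · rw [abs_smul_of_nonneg h, abs_of_nonneg h]
  · rw [← abs_neg, ← neg_smul, abs_smul_of_nonneg (neg_nonneg.mpr h), abs_of_nonpos h]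

/-- The disjoint complement of an element. -/
def disjointComplement [IsOrderedAddMonoid E] [IsOrderedModule ℝ E] (q : E) : Submodule ℝ E where
  carrier := {x | |x| ⊓ |q| = 0}
  zero_mem' := by simp
  add_mem' := fun {a b} ha hb => inf_eq_zero_of_le (abs_nonneg _) (abs_nonneg _) (abs_add_le a b)
    (add_inf_eq_zero (abs_nonneg a) (abs_nonneg b) (abs_nonneg q) ha hb)
  smul_mem' := fun r a ha => by
    simp only [Set.mem_ofPred_eq, abs_smul_eq] at ha ⊢
    exact smul_inf_eq_zero (abs_nonneg r) (abs_nonneg a) (abs_nonneg q) ha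

/-- For suprema: removing from `x⁺` its overlap with `|q|` still leaves an upper bound of `D`, so
the overlap is at most `x⁻`. But `x⁻` is dominated by `|d₀|` for a member `d₀` of `D`, hence is
disjoint from `|q|`, and the overlap vanishes. -/
theorem isBand_disjointComplement [IsOrderedAddMonoid E] [IsOrderedModule ℝ E] (q : E) :
    IsBand (disjointComplement q) where
  solid := fun a ha b hb => by
    exact inf_eq_zero_of_le (abs_nonneg _) (abs_nonneg _) hb ha
  mem_of_isLUB := fun D hD x hx => by
    -- A supremum of the empty set would be a least element of `E`, which forces it to be `0`.
    rcases D.eq_empty_or_nonempty with rfl | ⟨d₀, hd₀⟩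
    · have hb : ∀ y, x ≤ y := fun y => hx.2 (by simp)
      have h0 : x = 0 := le_antisymm (hb 0) (by simpa using hb (x + x))
      rw [h0]; exact Submodule.zero_mem _
    have hneg : x⁻ ⊓ |q| = 0 := by
      refine inf_eq_zero_of_le (negPart_nonneg _) (abs_nonneg _) (?_ : x⁻ ≤ |d₀|) (hD hd₀)
      exact (negPart_anti (hx.1 hd₀)).trans (sup_le (neg_le_abs _) (abs_nonneg _))
    have hv0 : 0 ≤ x⁺ ⊓ |q| := le_inf (posPart_nonneg _) (abs_nonneg _)
    have hub : x ≤ x⁺ - x⁺ ⊓ |q| := by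
      refine hx.2 fun d hd => ?_
      have hd1 : d⁺ ⊓ |q| = 0 := inf_eq_zero_of_le (posPart_nonneg _) (abs_nonneg _)
        (sup_le (le_abs_self _) (abs_nonneg _)) (hD hd)
      have hd2 : d⁺ ⊓ (x⁺ ⊓ |q|) = 0 := le_antisymm
        (hd1 ▸ inf_le_inf_left _ inf_le_right) (le_inf (posPart_nonneg _) hv0)
      have hd3 : d⁺ + x⁺ ⊓ |q| ≤ x⁺ := by
        rw [← inf_add_sup, hd2, zero_add]
        exact sup_le (posPart_mono (hx.1 hd)) inf_le_left
      exact (le_posPart d).trans (le_sub_iff_add_le.mpr hd3)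
    have hpos : x⁺ ⊓ |q| = 0 := by
      refine le_antisymm ?_ hv0
      have h1 : x⁺ ⊓ |q| ≤ x⁻ := by
        nth_rewrite 1 [← posPart_sub_negPart x] at hub
        exact (sub_le_sub_iff_left _).mp hub
      exact (le_inf h1 inf_le_right).trans_eq hneg
    change |x| ⊓ |q| = 0
    rw [← posPart_add_negPart]
    exact add_inf_eq_zero (posPart_nonneg _) (negPart_nonneg _) (abs_nonneg _) hpos hneg

end VectorLattice

/-! ### Monotonicity of orthomorphisms in absolute value -/

section OrthAbs

variable {E : Type*} [AddCommGroup E] [Module ℝ E] [Lattice E]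

theorem Orth.disjoint [IsOrderedAddMonoid E] [IsOrderedModule ℝ E] (T : Orth E) {x y : E}
    (h : |x| ⊓ |y| = 0) : |(T : Module.End ℝ E) x| ⊓ |y| = 0 :=
  T.2.1 (disjointComplement y) (isBand_disjointComplement y) x h

variable [IsArchimedeanVectorLattice E]

/-- Truncate `b = y - t • u` to `c` in `[-ε • u, ε • u]`. In `T y = t • T u + T c + T (b - c)` the
first two terms contribute at most `|T u| + ε • w`, so the excess lies below `|T (b - c)|`. This is
disjoint from the region where `|b| < ε • u`, since `b - c` is. -/
theorem Orth.posPart_inf_eq_zero (T : Orth E) {u y w : E} {t ε : ℝ} (hu : 0 ≤ u) (hε : 0 ≤ ε)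
    (ht : |t| ≤ 1) (hw : ∀ x, |x| ≤ u → |(T : Module.End ℝ E) x| ≤ w) :
    (|(T : Module.End ℝ E) y| - |(T : Module.End ℝ E) u| - ε • w)⁺ ⊓ (ε • u - |y - t • u|)⁺ = 0 := by
  set b := y - t • u with hb
  have hεu : 0 ≤ ε • u := smul_nonneg hε hu
  set c := (b ⊓ ε • u) ⊔ (-(ε • u)) with hc
  have hd := Orth.disjoint T (x := b - c) (y := (ε • u - |b|)⁺)
    (by rw [abs_of_nonneg (posPart_nonneg _)]; exact abs_sub_truncation_inf_eq_zero _ _)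
  rw [abs_of_nonneg (posPart_nonneg (ε • u - |b|))] at hd
  refine inf_eq_zero_of_le (posPart_nonneg _) (posPart_nonneg _) ?_ hd
  have hcu : |c| ≤ ε • u := abs_le'.mpr ⟨sup_le inf_le_right (neg_le_self hεu),
    by rw [hc, neg_sup, neg_neg]; exact inf_le_right⟩
  have hTc : |(T : Module.End ℝ E) c| ≤ ε • w := by
    rcases hε.eq_or_lt with rfl | hε'
    · rw [zero_smul] at hcu ⊢
      have : c = 0 := by
        have h := le_antisymm hcu (abs_nonneg c)
        exact le_antisymm ((le_abs_self c).trans hcu) (by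
          have := (neg_le_abs c).trans hcu
          exact neg_nonpos.mp this)
      rw [this]; simp
    · have h1 : |ε⁻¹ • c| ≤ u := by
        rw [abs_smul_of_nonneg (by positivity)]
        calc ε⁻¹ • |c| ≤ ε⁻¹ • (ε • u) := smul_le_smul_of_nonneg_left hcu (by positivity)
          _ = u := by rw [smul_smul, inv_mul_cancel₀ hε'.ne', one_smul]
      have h2 := hw _ h1
      rw [map_smul, abs_smul_of_nonneg (by positivity)] at h2
      have h3 := smul_le_smul_of_nonneg_left h2 hε
      rwa [smul_smul, mul_inv_cancel₀ hε'.ne', one_smul] at h3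
  refine sup_le ?_ (abs_nonneg _)
  have hy : y = t • u + c + (b - c) := by rw [hb]; abel
  have h1 : |(T : Module.End ℝ E) y| ≤ |(T : Module.End ℝ E) u| + ε • w
      + |(T : Module.End ℝ E) (b - c)| := by
    nth_rewrite 1 [hy]
    rw [map_add, map_add]
    refine (abs_add_le _ _).trans (add_le_add_left ((abs_add_le _ _).trans (add_le_add ?_ hTc)) _)
    rw [map_smul, abs_smul_eq]
    calc |t| • |(T : Module.End ℝ E) u| ≤ (1 : ℝ) • |(T : Module.End ℝ E) u| :=
          smul_le_smul_of_nonneg_right ht (abs_nonneg _)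
      _ = _ := one_smul _ _
  rw [sub_sub, sub_le_iff_le_add, add_comm]
  exact h1

/-- Induction along the grid `t = -1, -1 + 1/n, …, 1 + 1/n`, showing that the excess does not live
where `y < t • u`. At `t = -1` this region is empty. Moving up by `1/n` adds only points where `y`
is within `(1/n) • u` of `t • u`, which `Orth.posPart_inf_eq_zero` excludes. -/
theorem Orth.posPart_inf_negPart (T : Orth E) {u y w : E} (hy : |y| ≤ u)
    (hw : ∀ x, |x| ≤ u → |(T : Module.End ℝ E) x| ≤ w) {n : ℕ} (hn : 0 < n) (k : ℕ) (hk : k ≤ 2 * n + 1) :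
    (y - (((k : ℝ) - n) / n) • u)⁻ ⊓
      (|(T : Module.End ℝ E) y| - |(T : Module.End ℝ E) u| - (1 / (n : ℝ)) • w)⁺ = 0 := by
  have hn' : (0 : ℝ) < n := by exact_mod_cast hn
  have hu : 0 ≤ u := (abs_nonneg y).trans hy
  induction k with
  | zero =>
    have h0 : (y - ((((0 : ℕ) : ℝ) - n) / n) • u)⁻ = 0 := by
      rw [negPart_eq_zero]
      have : (((0 : ℕ) : ℝ) - n) / n = -1 := by field_simp; simp
      rw [this, neg_one_smul, sub_neg_eq_add]
      exact neg_le_iff_add_nonneg'.mp ((neg_le_abs y).trans hy)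
    rw [h0]
    exact inf_eq_left.mpr (posPart_nonneg _)
  | succ k ih =>
    have ih := ih (by omega)
    set c := y - (((k : ℝ) - n) / n) • u with hc
    have hk' : (k : ℝ) ≤ 2 * n := by exact_mod_cast (by omega : k ≤ 2 * n)
    have ht : |((k : ℝ) - n) / n| ≤ 1 := by
      rw [abs_div, abs_of_pos hn', div_le_one hn', abs_le]
      constructor <;> [linarith [(Nat.cast_nonneg k : (0:ℝ) ≤ k)]; linarith]
    have hz := Orth.posPart_inf_eq_zero T (y := y) hu (by positivity : 0 ≤ 1 / (n : ℝ)) ht hw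
    rw [inf_comm] at hz
    have hstep : y - ((((k + 1 : ℕ) : ℝ) - n) / n) • u = c - (1 / (n : ℝ)) • u := by
      rw [hc, sub_sub, ← add_smul]
      congr 2
      push_cast
      ring
    rw [hstep]
    refine inf_eq_zero_of_le (negPart_nonneg _) (posPart_nonneg _)
      (?_ : _ ≤ ((1 / (n : ℝ)) • u - |c|)⁺ + (c⁻ + c⁻)) ?_
    · refine sup_le ?_ (add_nonneg (posPart_nonneg _)
        (add_nonneg (negPart_nonneg _) (negPart_nonneg _)))
      have h1 := le_posPart ((1 / (n : ℝ)) • u - |c|)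
      calc -(c - (1 / (n : ℝ)) • u) = ((1 / (n : ℝ)) • u - |c|) + (c⁻ + c⁻) := by
            rw [abs_eq_self_add_two_negPart c]; abel
        _ ≤ _ := add_le_add_left h1 _
    · exact add_inf_eq_zero (posPart_nonneg _) (add_nonneg (negPart_nonneg _) (negPart_nonneg _))
        (posPart_nonneg _) hz (add_inf_eq_zero (negPart_nonneg _) (negPart_nonneg _)
        (posPart_nonneg _) ih ih)

/-- Orthomorphisms are monotone in absolute value. -/
theorem Orth.abs_le_abs (T : Orth E) {u y : E} (hy : |y| ≤ u) :
    |(T : Module.End ℝ E) y| ≤ |(T : Module.End ℝ E) u| := by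
  have hu : 0 ≤ u := (abs_nonneg y).trans hy
  obtain ⟨w, hw⟩ : ∃ w, ∀ x, |x| ≤ u → |(T : Module.End ℝ E) x| ≤ w := by
    obtain ⟨c, d, h⟩ := T.2.2 (-u) u
    refine ⟨|c| ⊔ |d|, fun x hx => ?_⟩
    have h1 := h x ⟨neg_le.mp ((neg_le_abs x).trans hx), (le_abs_self x).trans hx⟩
    exact abs_le'.mpr ⟨(h1.2.trans (le_abs_self d)).trans le_sup_right,
      ((neg_le_neg h1.1).trans (neg_le_abs c)).trans le_sup_left⟩
  rw [← sub_nonpos]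
  refine IsArchimedeanVectorLattice.archimedean _ w fun n => ?_
  rcases n.eq_zero_or_pos with rfl | hn
  · rw [zero_smul]
    exact (abs_nonneg _).trans (hw u (abs_of_nonneg hu).le)
  have hn' : (0 : ℝ) < n := by exact_mod_cast hn
  set q := (|(T : Module.End ℝ E) y| - |(T : Module.End ℝ E) u| - (1 / (n : ℝ)) • w)⁺ with hq
  have hq0 : 0 ≤ q := posPart_nonneg _
  have hw0 : 0 ≤ w := (abs_nonneg _).trans (hw u (abs_of_nonneg hu).le)
  -- At the last grid point `t = 1 + 1/n`, the negative part of `y - t • u` is at least `(1/n) • u`,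
  -- so `q` is disjoint from all of `u`.
  have h1 := Orth.posPart_inf_negPart T hy hw hn (2 * n + 1) le_rfl
  have h2 : (1 / (n : ℝ)) • u ⊓ q = 0 := by
    refine inf_eq_zero_of_le (smul_nonneg (by positivity) hu) hq0 ?_ h1
    refine le_trans ?_ (neg_le_negPart _)
    have : (((2 * n + 1 : ℕ) : ℝ) - n) / n = 1 + 1 / n := by push_cast; field_simp; ring
    rw [this, add_smul, one_smul, neg_sub, add_comm, add_sub_assoc]
    exact le_add_of_nonneg_right (sub_nonneg.mpr ((le_abs_self y).trans hy))
  have h3 : u ⊓ q = 0 := by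
    have := smul_inf_eq_zero hn'.le (smul_nonneg (by positivity) hu) hq0 h2
    rwa [smul_smul, mul_one_div_cancel hn'.ne', one_smul] at this
  have h4 : |y| ⊓ |q| = 0 := by
    rw [abs_of_nonneg hq0]
    exact inf_eq_zero_of_le (abs_nonneg y) hq0 hy h3
  have h5 := Orth.disjoint T h4
  rw [abs_of_nonneg hq0] at h5
  -- Now `q` is both dominated by `|T y|` and disjoint from it, so it is `0`.
  have h6 : q ≤ |(T : Module.End ℝ E) y| := by
    refine sup_le ?_ (abs_nonneg _)
    rw [sub_sub]
    exact sub_le_self _ (add_nonneg (abs_nonneg _) (smul_nonneg (by positivity) hw0))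
  rw [inf_eq_right.mpr h6] at h5
  have h7 := (le_posPart _).trans_eq h5
  rw [sub_nonpos] at h7
  have h8 := smul_le_smul_of_nonneg_left h7 hn'.le
  rw [smul_smul, mul_one_div_cancel hn'.ne', one_smul, Nat.cast_smul_eq_nsmul] at h8
  exact h8

end OrthAbs

/-! ### The f-algebra of orthomorphisms -/

section OrthLattice

variable {E : Type*} [AddCommGroup E] [Module ℝ E] [Lattice E]

theorem Orth.ext_of_nonneg [IsOrderedAddMonoid E] [IsOrderedModule ℝ E] {S T : Orth E}
    (h : ∀ x : E, 0 ≤ x → (S : Module.End ℝ E) x = (T : Module.End ℝ E) x) : S = T := by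
  refine Subtype.ext (LinearMap.ext fun x => ?_)
  rw [← posPart_sub_negPart x, map_sub, map_sub, h _ (posPart_nonneg x), h _ (negPart_nonneg x)]

theorem half_smul_add_add_abs_sub [IsOrderedAddMonoid E] (a b : E) : (1 / 2 : ℝ) • (a + b + |a - b|) = a ⊔ b := by
  rw [abs_sub_comm, ← two_nsmul_sup_eq_add_add_abs_sub, ← Nat.cast_smul_eq_nsmul ℝ, smul_smul]
  norm_num

theorem half_smul_add_sub_abs_sub [IsOrderedAddMonoid E] (a b : E) : (1 / 2 : ℝ) • (a + b - |a - b|) = a ⊓ b := by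
  rw [abs_sub_comm, ← two_nsmul_inf_eq_add_sub_abs_sub, ← Nat.cast_smul_eq_nsmul ℝ, smul_smul]
  norm_num

variable [IsArchimedeanVectorLattice E]

/-- As `|x - y| ≤ x + y`, monotonicity shows that `|T (x + y)|` is the larger term in
`abs_add_abs_eq_sup`. -/
theorem Orth.abs_apply_add (T : Orth E) {x y : E} (hx : 0 ≤ x) (hy : 0 ≤ y) :
    |(T : Module.End ℝ E) (x + y)| = |(T : Module.End ℝ E) x| + |(T : Module.End ℝ E) y| := by
  rw [abs_add_abs_eq_sup, ← map_add, ← map_sub, sup_eq_left.mpr]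
  refine Orth.abs_le_abs T (abs_le'.mpr ⟨?_, ?_⟩)
  · exact (sub_le_self x hy).trans (le_add_of_nonneg_right hy)
  · rw [neg_sub]; exact (sub_le_self y hx).trans (le_add_of_nonneg_left hx)

/-- Makes the extension of `x ↦ |T x|` from the positive cone independent of how a vector is written
as a difference of positive ones. -/
theorem Orth.abs_sub_abs_congr (T : Orth E) {a b c d : E} (ha : 0 ≤ a) (hb : 0 ≤ b) (hc : 0 ≤ c)
    (hd : 0 ≤ d) (h : a - b = c - d) :
    |(T : Module.End ℝ E) a| - |(T : Module.End ℝ E) b|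
      = |(T : Module.End ℝ E) c| - |(T : Module.End ℝ E) d| := by
  rw [sub_eq_sub_iff_add_eq_add] at h ⊢
  rw [← Orth.abs_apply_add T ha hd, ← Orth.abs_apply_add T hc hb, h]

/-- The modulus of an orthomorphism, as a linear map. -/
noncomputable def Orth.modulusHom (T : Orth E) : Module.End ℝ E where
  toFun x := |(T : Module.End ℝ E) x⁺| - |(T : Module.End ℝ E) x⁻|
  map_add' x y := by
    rw [sub_add_sub_comm, ← Orth.abs_apply_add T (posPart_nonneg x) (posPart_nonneg y),
      ← Orth.abs_apply_add T (negPart_nonneg x) (negPart_nonneg y)]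
    refine Orth.abs_sub_abs_congr T (posPart_nonneg _) (negPart_nonneg _)
      (add_nonneg (posPart_nonneg _) (posPart_nonneg _))
      (add_nonneg (negPart_nonneg _) (negPart_nonneg _)) ?_
    rw [add_sub_add_comm]
    simp only [posPart_sub_negPart]
  map_smul' r x := by
    rcases le_total 0 r with hr | hr
    · rw [RingHom.id_apply, smul_sub, ← abs_smul_of_nonneg hr, ← abs_smul_of_nonneg hr, ← map_smul,
        ← map_smul]
      refine Orth.abs_sub_abs_congr T (posPart_nonneg _) (negPart_nonneg _)
        (smul_nonneg hr (posPart_nonneg _)) (smul_nonneg hr (negPart_nonneg _)) ?_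
      rw [← smul_sub, posPart_sub_negPart, posPart_sub_negPart]
    -- A nonpositive scalar interchanges the roles of `x⁺` and `x⁻`.
    · have hr' := neg_nonneg.mpr hr
      rw [RingHom.id_apply, ← neg_neg r, neg_smul (-r) (_ - _), ← smul_neg, neg_sub, smul_sub,
        ← abs_smul_of_nonneg hr', ← abs_smul_of_nonneg hr', ← map_smul, ← map_smul]
      refine Orth.abs_sub_abs_congr T (posPart_nonneg _) (negPart_nonneg _)
        (smul_nonneg hr' (negPart_nonneg _)) (smul_nonneg hr' (posPart_nonneg _)) ?_
      rw [← smul_sub, posPart_sub_negPart, ← neg_sub x⁺ x⁻, posPart_sub_negPart, neg_neg]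
      simp

theorem Orth.modulusHom_apply (T : Orth E) {x : E} (hx : 0 ≤ x) :
    Orth.modulusHom T x = |(T : Module.End ℝ E) x| := by
  change |(T : Module.End ℝ E) x⁺| - |(T : Module.End ℝ E) x⁻| = _
  rw [posPart_of_nonneg hx, negPart_of_nonneg hx]
  simp

/-- The modulus of an orthomorphism. -/
noncomputable def Orth.modulus (T : Orth E) : Orth E :=
  ⟨Orth.modulusHom T, by
    constructor
    · intro S hS x hx
      refine S.sub_mem (hS.solid (T.2.1 S hS x⁺ (hS.solid hx ?_)) (abs_abs _).le)
        (hS.solid (T.2.1 S hS x⁻ (hS.solid hx ?_)) (abs_abs _).le)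
      · rw [abs_of_nonneg (posPart_nonneg _), ← posPart_add_negPart]
        exact le_add_of_nonneg_right (negPart_nonneg _)
      · rw [abs_of_nonneg (negPart_nonneg _), ← posPart_add_negPart]
        exact le_add_of_nonneg_left (posPart_nonneg _)
    · intro a b
      have mono : ∀ x y : E, x ≤ y → Orth.modulusHom T x ≤ Orth.modulusHom T y := by
        intro x y hxy
        rw [← sub_nonneg, ← map_sub, Orth.modulusHom_apply T (sub_nonneg.mpr hxy)]
        exact abs_nonneg _
      exact ⟨_, _, fun x hx => ⟨mono _ _ hx.1, mono _ _ hx.2⟩⟩⟩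

theorem Orth.modulus_apply (T : Orth E) {x : E} (hx : 0 ≤ x) :
    (Orth.modulus T : Module.End ℝ E) x = |(T : Module.End ℝ E) x| :=
  Orth.modulusHom_apply T hx

theorem Orth.sup_apply_aux (S T : Orth E) {x : E} (hx : 0 ≤ x) :
    (((1 / 2 : ℝ) • (S + T + Orth.modulus (S - T)) : Orth E) : Module.End ℝ E) x
      = (S : Module.End ℝ E) x ⊔ (T : Module.End ℝ E) x := by
  rw [← half_smul_add_add_abs_sub]
  change (1 / 2 : ℝ) • (_ + _ + (Orth.modulus (S - T) : Module.End ℝ E) x) = _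
  rw [Orth.modulus_apply _ hx]
  rfl

theorem Orth.inf_apply_aux (S T : Orth E) {x : E} (hx : 0 ≤ x) :
    (((1 / 2 : ℝ) • (S + T - Orth.modulus (S - T)) : Orth E) : Module.End ℝ E) x
      = (S : Module.End ℝ E) x ⊓ (T : Module.End ℝ E) x := by
  rw [← half_smul_add_sub_abs_sub]
  change (1 / 2 : ℝ) • (_ + _ - (Orth.modulus (S - T) : Module.End ℝ E) x) = _
  rw [Orth.modulus_apply _ hx]
  rfl

/-- The lattice of orthomorphisms. -/
noncomputable abbrev Orth.lattice : Lattice (Orth E) where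
  le S T := ∀ x : E, 0 ≤ x → (S : Module.End ℝ E) x ≤ (T : Module.End ℝ E) x
  le_refl _ _ _ := le_rfl
  le_trans _ _ _ h h' x hx := (h x hx).trans (h' x hx)
  le_antisymm _ _ h h' := Orth.ext_of_nonneg fun x hx => le_antisymm (h x hx) (h' x hx)
  sup S T := (1 / 2 : ℝ) • (S + T + Orth.modulus (S - T))
  inf S T := (1 / 2 : ℝ) • (S + T - Orth.modulus (S - T))
  le_sup_left S T x hx := by rw [Orth.sup_apply_aux S T hx]; exact le_sup_left
  le_sup_right S T x hx := by rw [Orth.sup_apply_aux S T hx]; exact le_sup_right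
  sup_le S T U h h' x hx := by rw [Orth.sup_apply_aux S T hx]; exact sup_le (h x hx) (h' x hx)
  inf_le_left S T x hx := by rw [Orth.inf_apply_aux S T hx]; exact inf_le_left
  inf_le_right S T x hx := by rw [Orth.inf_apply_aux S T hx]; exact inf_le_right
  le_inf S T U h h' x hx := by rw [Orth.inf_apply_aux T U hx]; exact le_inf (h x hx) (h' x hx)

attribute [local instance] Orth.lattice

theorem Orth.le_iff {S T : Orth E} :
    S ≤ T ↔ ∀ x : E, 0 ≤ x → (S : Module.End ℝ E) x ≤ (T : Module.End ℝ E) x := Iff.rfl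

theorem Orth.inf_apply (S T : Orth E) {x : E} (hx : 0 ≤ x) :
    ((S ⊓ T : Orth E) : Module.End ℝ E) x = (S : Module.End ℝ E) x ⊓ (T : Module.End ℝ E) x :=
  Orth.inf_apply_aux S T hx

theorem Orth.sup_apply (S T : Orth E) {x : E} (hx : 0 ≤ x) :
    ((S ⊔ T : Orth E) : Module.End ℝ E) x = (S : Module.End ℝ E) x ⊔ (T : Module.End ℝ E) x :=
  Orth.sup_apply_aux S T hx

theorem Orth.abs_apply (T : Orth E) {x : E} (hx : 0 ≤ x) :
    ((|T| : Orth E) : Module.End ℝ E) x = |(T : Module.End ℝ E) x| :=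
  Orth.sup_apply T (-T) hx

theorem Orth.inf_eq_zero_iff {S T : Orth E} : S ⊓ T = 0 ↔
    ∀ x : E, 0 ≤ x → (S : Module.End ℝ E) x ⊓ (T : Module.End ℝ E) x = 0 := by
  refine ⟨fun h x hx => ?_, fun h => Orth.ext_of_nonneg fun x hx => ?_⟩
  · rw [← Orth.inf_apply S T hx, h]; rfl
  · rw [Orth.inf_apply S T hx, h x hx]; rfl

theorem Orth.mono {T : Orth E} (hT : 0 ≤ T) {x y : E} (hxy : x ≤ y) :
    (T : Module.End ℝ E) x ≤ (T : Module.End ℝ E) y := by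
  rw [← sub_nonneg, ← map_sub]
  exact hT _ (sub_nonneg.mpr hxy)

theorem Orth.abs_apply_le (T : Orth E) (x : E) :
    |(T : Module.End ℝ E) x| ≤ ((|T| : Orth E) : Module.End ℝ E) |x| := by
  rw [Orth.abs_apply T (abs_nonneg x)]
  exact Orth.abs_le_abs T le_rfl

theorem Orth.isFAlgebra : IsFAlgebra (Orth E) where
  add_le_add_left S T h U x hx := add_le_add_left (h x hx) _
  smul_le_smul_of_nonneg_left r hr S T h x hx := smul_le_smul_of_nonneg_left (h x hx) hr
  smul_le_smul_of_nonneg_right T hT r s h x hx := smul_le_smul_of_nonneg_right h (hT x hx)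
  archimedean S T h x hx := by
    refine IsArchimedeanVectorLattice.archimedean _ ((T : Module.End ℝ E) x) fun n => ?_
    exact h n x hx
  mul_nonneg S T hS hT x hx := hS _ (hT x hx)
  mul_left_inf S T U h hU := by
    rw [Orth.inf_eq_zero_iff] at h ⊢
    intro x hx
    have hS0 : 0 ≤ (S : Module.End ℝ E) x := (h x hx).symm.le.trans inf_le_left
    have hT0 : 0 ≤ (T : Module.End ℝ E) x := (h x hx).symm.le.trans inf_le_right
    have h1 := Orth.disjoint U (x := (S : Module.End ℝ E) x) (y := (T : Module.End ℝ E) x)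
      (by rw [abs_of_nonneg hS0, abs_of_nonneg hT0, h x hx])
    rwa [abs_of_nonneg (hU _ hS0), abs_of_nonneg hT0] at h1
  mul_right_inf S T U h hU := by
    rw [Orth.inf_eq_zero_iff] at h ⊢
    intro x hx
    have hS : 0 ≤ S := fun y hy => (h y hy).symm.le.trans inf_le_left
    have hT : 0 ≤ T := fun y hy => (h y hy).symm.le.trans inf_le_right
    have hUx := hU x hx
    -- `S (U x)` and `T x` are dominated by the values of `S` and `T` at the common point `U x + x`,
    -- where these are disjoint.
    have hy := add_nonneg hUx hx
    refine le_antisymm ?_ (le_inf (hS _ hUx) (hT _ hx))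
    rw [← h _ hy]
    exact inf_le_inf (Orth.mono hS (le_add_of_nonneg_right hx))
      (Orth.mono hT (le_add_of_nonneg_left hUx))

end OrthLattice

/-! ### Multiplication in f-algebras -/

section FAlgebra

variable {A : Type*} [Ring A] [Algebra ℝ A] [Lattice A] [IsFAlgebra A]

/-- Multiplying first `a` by `b` and then `b` by `a` keeps the two disjoint, so `a * b` is disjoint
from itself. -/
theorem mul_eq_zero_of_inf_eq_zero {a b : A} (h : a ⊓ b = 0) : a * b = 0 := by
  have ha : 0 ≤ a := h.symm.le.trans inf_le_left
  have hb : 0 ≤ b := h.symm.le.trans inf_le_right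
  have h1 := IsFAlgebra.mul_right_inf a b b h hb
  rw [inf_comm] at h1
  simpa using IsFAlgebra.mul_left_inf b (a * b) a h1 ha

theorem abs_mul_abs_eq_mul_self (a : A) : |a| * |a| = a * a := by
  have h1 : a⁺ * a⁻ = 0 := mul_eq_zero_of_inf_eq_zero (posPart_inf_negPart_eq_zero a)
  have h2 : a⁻ * a⁺ = 0 := mul_eq_zero_of_inf_eq_zero
    (by rw [inf_comm]; exact posPart_inf_negPart_eq_zero a)
  calc |a| * |a| = (a⁺ + a⁻) * (a⁺ + a⁻) := by rw [posPart_add_negPart]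
    _ = (a⁺ - a⁻) * (a⁺ - a⁻) := by
      simp only [add_mul, mul_add, sub_mul, mul_sub, h1, h2]
      abel
    _ = a * a := by rw [posPart_sub_negPart]

theorem IsFAlgebra.mul_le_mul_left {a b c : A} (h : a ≤ b) (hc : 0 ≤ c) : c * a ≤ c * b := by
  rw [← sub_nonneg, ← mul_sub]
  exact IsFAlgebra.mul_nonneg _ _ hc (sub_nonneg.mpr h)

theorem IsFAlgebra.mul_le_mul_right {a b c : A} (h : a ≤ b) (hc : 0 ≤ c) : a * c ≤ b * c := by
  rw [← sub_nonneg, ← sub_mul]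
  exact IsFAlgebra.mul_nonneg _ _ (sub_nonneg.mpr h) hc

theorem posPart_mul_self_eq (a : A) : a⁺ * a = a⁺ * a⁺ := by
  have h : a⁺ * (a⁺ - a⁻) = a⁺ * a⁺ := by
    rw [mul_sub, mul_eq_zero_of_inf_eq_zero (posPart_inf_negPart_eq_zero a), sub_zero]
  rwa [posPart_sub_negPart] at h

/-- On the band where `a ≥ r`, the powers of `a` dominate those of `r`. -/
theorem pow_smul_posPart_le {a : A} (ha : 0 ≤ a) {r : ℝ} (hr : 0 ≤ r) (k : ℕ) :
    r ^ k • (a - r • (1 : A))⁺ ≤ (a - r • (1 : A))⁺ * a ^ k := by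
  set p := (a - r • (1 : A))⁺ with hp
  have hp0 : 0 ≤ p := posPart_nonneg _
  -- `p` annihilates the negative part of `a - r • 1`, so `p * (a - r • 1) = p * p ≥ 0`.
  have h1 : r • p ≤ p * a := by
    have h2 : p * (a - r • (1 : A)) = p * p := by
      exact posPart_mul_self_eq _
    rw [← sub_nonneg]
    have h3 : p * a - r • p = p * p := by rw [← h2, mul_sub, mul_smul_comm, mul_one]
    rw [h3]
    exact IsFAlgebra.mul_nonneg _ _ hp0 hp0
  induction k with
  | zero => simp
  | succ k ih =>
    calc r ^ (k + 1) • p = r ^ k • (r • p) := by rw [smul_smul, pow_succ]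
      _ ≤ r ^ k • (p * a) := smul_le_smul_of_nonneg_left h1 (by positivity)
      _ = (r ^ k • p) * a := by rw [smul_mul_assoc]
      _ ≤ (p * a ^ k) * a := IsFAlgebra.mul_le_mul_right ih ha
      _ = p * a ^ (k + 1) := by rw [mul_assoc, pow_succ]

end FAlgebra

/-! ### The order unit norm is attained -/

section OrderUnit

variable {V : Type*} [AddCommGroup V] [Module ℝ V] [Lattice V] [IsArchimedeanVectorLattice V]

theorem le_of_forall_pos_add_smul_le {a b e : V} (h : ∀ ε : ℝ, 0 < ε → a ≤ b + ε • e) : a ≤ b := by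
  rw [← sub_nonpos]
  refine IsArchimedeanVectorLattice.archimedean _ (|e| + |a - b|) fun n => ?_
  rcases n.eq_zero_or_pos with rfl | hn
  · rw [zero_smul]; exact add_nonneg (abs_nonneg _) (abs_nonneg _)
  have hn' : (0 : ℝ) < n := by exact_mod_cast hn
  have h1 := smul_le_smul_of_nonneg_left
    (sub_le_iff_le_add'.mpr (h (1 / n) (by positivity))) hn'.le
  rw [smul_smul, mul_one_div_cancel hn'.ne', one_smul, Nat.cast_smul_eq_nsmul] at h1
  exact h1.trans ((le_abs_self e).trans (le_add_of_nonneg_right (abs_nonneg _)))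

theorem IsOrderUnit.abs_le {e : V} (he : IsOrderUnit e) (x : V) : |x| ≤ orderUnitNorm e x • e := by
  refine le_of_forall_pos_add_smul_le (e := e) fun ε hε => ?_
  obtain ⟨r, -, hr, hx⟩ := he.exists_lt x (lt_add_of_pos_right (orderUnitNorm e x) hε)
  rw [← add_smul]
  exact hx.trans (smul_le_smul_of_nonneg_right hr.le he.1)

end OrderUnit

/-! ### Positive operators on Banach lattices -/

section BanachLattice

theorem norm_le_norm_of_nonneg_of_le {E : Type*} [NormedAddCommGroup E] [Lattice E]
    [IsOrderedAddMonoid E] [HasSolidNorm E] {x y : E} (hx : 0 ≤ x) (h : x ≤ y) : ‖x‖ ≤ ‖y‖ :=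
  norm_le_norm_of_abs_le_abs (by rwa [abs_of_nonneg hx, abs_of_nonneg (hx.trans h)])

variable {E : Type*} [NormedAddCommGroup E] [NormedSpace ℝ E] [Lattice E]
  [IsOrderedAddMonoid E] [IsOrderedModule ℝ E] [HasSolidNorm E]

/-- `x ≤ y / (n + 1)` for all `n`, and order intervals are norm closed. -/
theorem HasSolidNorm.isArchimedeanVectorLattice : IsArchimedeanVectorLattice E where
  archimedean x y h := by
    have h1 : ∀ n : ℕ, x ≤ (1 / ((n : ℝ) + 1)) • y := fun n => by
      have h2 := smul_le_smul_of_nonneg_left (h (n + 1))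
        (by positivity : (0 : ℝ) ≤ 1 / ((n : ℝ) + 1))
      rwa [← Nat.cast_smul_eq_nsmul ℝ, smul_smul, Nat.cast_succ, one_div_mul_cancel (by positivity),
        one_smul] at h2
    have h3 : Filter.Tendsto (fun n : ℕ => (1 / ((n : ℝ) + 1)) • y) Filter.atTop (nhds 0) := by
      simpa using (tendsto_one_div_add_atTop_nhds_zero_nat (𝕜 := ℝ)).smul_const y
    exact ge_of_tendsto' h3 h1

/-- Positive linear maps on a Banach lattice are bounded. -/
theorem exists_bound_of_nonneg [CompleteSpace E] (T : Module.End ℝ E) (hT : ∀ x, 0 ≤ x → 0 ≤ T x) :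
    ∃ M : ℝ, 0 ≤ M ∧ ∀ x, ‖T x‖ ≤ M * ‖x‖ := by
  have mono : ∀ x y, x ≤ y → T x ≤ T y := fun x y h => by
    rw [← sub_nonneg, ← map_sub]; exact hT _ (sub_nonneg.mpr h)
  by_contra! hc
  -- If `T` is unbounded, there are positive vectors of norm `2⁻ⁿ` with images of norm above `2ⁿ`;
  -- their sum dominates each of them, which is absurd. The factor `4 ^ n` is `2 ^ n` for the image
  -- times `2 ^ n` for the rescaling.
  have key : ∀ n : ℕ, ∃ y : E, 0 ≤ y ∧ ‖y‖ = (1 / 2) ^ n ∧ 2 ^ n < ‖T y‖ := by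
    intro n
    obtain ⟨x, hx⟩ := hc (4 ^ n) (by positivity)
    have hx0 : 0 < ‖x‖ := by
      rw [norm_pos_iff]
      rintro rfl
      simp at hx
    have h1 : ‖T x‖ ≤ ‖T |x|‖ := by
      refine norm_le_norm_of_abs_le_abs ?_
      rw [abs_of_nonneg (hT _ (abs_nonneg x))]
      refine abs_le'.mpr ⟨mono _ _ (le_abs_self x), ?_⟩
      rw [← map_neg]
      exact mono _ _ (neg_le_abs x)
    refine ⟨((1 / 2) ^ n * ‖x‖⁻¹) • |x|, smul_nonneg (by positivity) (abs_nonneg x), ?_, ?_⟩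
    · rw [norm_smul, norm_abs_eq_norm, Real.norm_of_nonneg (by positivity), mul_assoc,
        inv_mul_cancel₀ hx0.ne', mul_one]
    · rw [map_smul, norm_smul, Real.norm_of_nonneg (by positivity)]
      calc (2 : ℝ) ^ n = (1 / 2) ^ n * ‖x‖⁻¹ * (4 ^ n * ‖x‖) := by
            have : (4 : ℝ) ^ n = 2 ^ n * 2 ^ n := by rw [← mul_pow]; norm_num
            rw [this]; field_simp; rw [← mul_pow]; norm_num
        _ < (1 / 2) ^ n * ‖x‖⁻¹ * ‖T |x|‖ := by gcongr; exact hx.trans_le h1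
  choose y hy0 hyn hyT using key
  have hs : Summable y := Summable.of_norm (by
    simp only [hyn]; exact summable_geometric_of_lt_one (by norm_num) (by norm_num))
  have hle : ∀ n, (2 : ℝ) ^ n < ‖T (∑' i, y i)‖ := fun n =>
    (hyT n).trans_le (norm_le_norm_of_nonneg_of_le (hT _ (hy0 n))
      (mono _ _ (hs.le_tsum n fun i _ => hy0 i)))
  obtain ⟨n, hn⟩ := pow_unbounded_of_one_lt ‖T (∑' i, y i)‖ (by norm_num : (1 : ℝ) < 2)
  exact (hn.trans (hle n)).false

end BanachLattice

/-! ### Operator norm and completeness of the orthomorphisms -/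

section OrthBanach

variable {E : Type*} [NormedAddCommGroup E] [NormedSpace ℝ E] [Lattice E]
  [IsArchimedeanVectorLattice E]

attribute [local instance] Orth.lattice Orth.isFAlgebra

theorem Orth.norm_pow_apply_le {T : Orth E} {M : ℝ} (hM : 0 ≤ M)
    (h : ∀ x, 0 ≤ x → ‖(T : Module.End ℝ E) x‖ ≤ M * ‖x‖) (hT : 0 ≤ T) (k : ℕ) {x : E} (hx : 0 ≤ x) :
    0 ≤ ((T ^ k : Orth E) : Module.End ℝ E) x ∧
      ‖((T ^ k : Orth E) : Module.End ℝ E) x‖ ≤ M ^ k * ‖x‖ := by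
  induction k with
  | zero => simpa using hx
  | succ k ih =>
    rw [pow_succ']
    refine ⟨hT _ ih.1, (h _ ih.1).trans ?_⟩
    rw [pow_succ', mul_assoc]
    exact mul_le_mul_of_nonneg_left ih.2 hM

theorem Orth.abs_apply_le_smul {T : Orth E} {r : ℝ} (h : |T| ≤ r • (1 : Orth E)) (x : E) :
    |(T : Module.End ℝ E) x| ≤ r • |x| :=
  (Orth.abs_apply_le T x).trans (h |x| (abs_nonneg x))

variable [HasSolidNorm E]

theorem Orth.norm_apply_le {T : Orth E} {r : ℝ} (hr : 0 ≤ r) (h : |T| ≤ r • (1 : Orth E)) (x : E) :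
    ‖(T : Module.End ℝ E) x‖ ≤ r * ‖x‖ := by
  have h1 := norm_le_norm_of_abs_le_abs ((Orth.abs_apply_le_smul h x).trans (le_abs_self _))
  rwa [norm_smul, norm_abs_eq_norm, Real.norm_of_nonneg hr] at h1

variable [CompleteSpace E]

theorem Orth.exists_bound (T : Orth E) :
    ∃ M : ℝ, 0 ≤ M ∧ ∀ x, ‖(T : Module.End ℝ E) x‖ ≤ M * ‖x‖ := by
  have h0 : ∀ x, 0 ≤ x → 0 ≤ ((|T| : Orth E) : Module.End ℝ E) x := fun x hx => by
    rw [Orth.abs_apply T hx]; exact abs_nonneg _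
  obtain ⟨M, hM, h⟩ := exists_bound_of_nonneg ((|T| : Orth E) : Module.End ℝ E) h0
  refine ⟨M, hM, fun x => ?_⟩
  calc ‖(T : Module.End ℝ E) x‖ ≤ ‖((|T| : Orth E) : Module.End ℝ E) |x|‖ := by
        refine norm_le_norm_of_abs_le_abs ?_
        rw [abs_of_nonneg (h0 _ (abs_nonneg x))]
        exact Orth.abs_apply_le T x
    _ ≤ M * ‖x‖ := by simpa [norm_abs_eq_norm] using h |x|

/-- The modulus of an orthomorphism is dominated by its operator norm. -/
theorem Orth.abs_le_smul_one {T : Orth E} {M : ℝ} (hM : 0 ≤ M)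
    (h : ∀ x, ‖(T : Module.End ℝ E) x‖ ≤ M * ‖x‖) : |T| ≤ M • (1 : Orth E) := by
  refine le_of_forall_pos_add_smul_le (e := (1 : Orth E)) fun ε hε => ?_
  rw [← add_smul]
  set r := M + ε with hr
  have hr0 : 0 < r := by positivity
  have hU : ∀ x, 0 ≤ x → ‖((|T| : Orth E) : Module.End ℝ E) x‖ ≤ M * ‖x‖ := fun x hx => by
    rw [Orth.abs_apply T hx, norm_abs_eq_norm]; exact h x
  set R : Orth E := (|T| - r • (1 : Orth E))⁺ with hR
  have hR0 : 0 ≤ R := posPart_nonneg _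
  obtain ⟨C, hC, hRC⟩ := Orth.exists_bound R
  suffices hz : R = 0 by
    have := (le_posPart (|T| - r • (1 : Orth E))).trans_eq hz
    rwa [sub_nonpos] at this
  refine Orth.ext_of_nonneg fun x hx => ?_
  -- From `r ^ k • R ≤ R * |T| ^ k`; since `M < r`, the bound tends to `0`.
  have h1 : ∀ k : ℕ, ‖(R : Module.End ℝ E) x‖ ≤ C * ‖x‖ * (M / r) ^ k := by
    intro k
    obtain ⟨hk0, hk⟩ := Orth.norm_pow_apply_le hM hU (abs_nonneg T) k hx
    have h2 : r ^ k • (R : Module.End ℝ E) x ≤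
        (R : Module.End ℝ E) (((|T| ^ k : Orth E) : Module.End ℝ E) x) :=
      pow_smul_posPart_le (abs_nonneg T) hr0.le k x hx
    have h3 := norm_le_norm_of_nonneg_of_le (smul_nonneg (by positivity) (hR0 x hx)) h2
    rw [norm_smul, Real.norm_of_nonneg (by positivity)] at h3
    have h4 := h3.trans ((hRC _).trans (mul_le_mul_of_nonneg_left hk hC))
    rw [div_pow, mul_div_assoc', le_div_iff₀ (by positivity)]
    linarith
  have h5 : Filter.Tendsto (fun k : ℕ => C * ‖x‖ * (M / r) ^ k) Filter.atTop (nhds 0) := by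
    simpa using (tendsto_pow_atTop_nhds_zero_of_lt_one (by positivity)
      (by rw [div_lt_one hr0]; linarith : M / r < 1)).const_mul (C * ‖x‖)
  have h6 := ge_of_tendsto' h5 h1
  simpa using norm_le_zero_iff.mp h6

theorem Orth.isOrderUnit_one : IsOrderUnit (1 : Orth E) := by
  refine ⟨fun x hx => hx, fun T => ?_⟩
  obtain ⟨M, hM, h⟩ := Orth.exists_bound T
  exact ⟨M, hM, Orth.abs_le_smul_one hM h⟩

theorem Orth.exists_continuousLinearMap (T : Orth E) :
    ∃ T' : E →L[ℝ] E, (∀ x : E, T' x = (T : Module.End ℝ E) x) ∧ ‖T'‖ = orderUnitNorm 1 T := by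
  obtain ⟨M, hM, h⟩ := Orth.exists_bound T
  refine ⟨LinearMap.mkContinuous (T : Module.End ℝ E) M h, fun x => rfl, le_antisymm ?_ ?_⟩
  · refine ContinuousLinearMap.opNorm_le_bound _ (orderUnitNorm_nonneg _ _) fun x => ?_
    exact Orth.norm_apply_le (orderUnitNorm_nonneg _ _) (Orth.isOrderUnit_one.abs_le T) x
  · refine orderUnitNorm_le (norm_nonneg _) (Orth.abs_le_smul_one (norm_nonneg _) fun x => ?_)
    exact ContinuousLinearMap.le_opNorm (LinearMap.mkContinuous (T : Module.End ℝ E) M h) x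

/-- The estimate `|T n x - T m x| ≤ dist (T n) (T m) • |x|` gives pointwise limits and survives the
passage to the limit, which makes the convergence uniform in the order unit norm. -/
theorem Orth.completeSpace (hu : IsOrderUnit (1 : Orth E)) :
    letI := hu.normedAddCommGroup
    CompleteSpace (Orth E) := by
  let := hu.normedAddCommGroup
  refine Metric.complete_of_cauchySeq_tendsto fun T hT => ?_
  have hdist : ∀ n m, dist (T n) (T m) = orderUnitNorm 1 (T n - T m) := fun n m => dist_eq_norm _ _
  have hsub : ∀ n m x, |(T n : Module.End ℝ E) x - (T m : Module.End ℝ E) x|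
      ≤ dist (T n) (T m) • |x| := fun n m x => by
    rw [hdist]
    exact Orth.abs_apply_le_smul (hu.abs_le (T n - T m)) x
  have hcau : ∀ x, CauchySeq fun n => (T n : Module.End ℝ E) x := fun x => by
    refine Metric.cauchySeq_iff'.mpr fun ε hε => ?_
    obtain ⟨N, hN⟩ := Metric.cauchySeq_iff'.mp hT (ε / (‖x‖ + 1)) (by positivity)
    refine ⟨N, fun n hn => ?_⟩
    have h1 := norm_le_norm_of_abs_le_abs ((hsub n N x).trans (le_abs_self _))
    rw [norm_smul, norm_abs_eq_norm, Real.norm_of_nonneg dist_nonneg] at h1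
    rw [dist_eq_norm]
    refine h1.trans_lt ?_
    have h2 := hN n hn
    rw [lt_div_iff₀ (by positivity)] at h2
    nlinarith [norm_nonneg x, (dist_nonneg : 0 ≤ dist (T n) (T N))]
  choose L hL using fun x => cauchySeq_tendsto_of_complete (hcau x)
  have hest : ∀ ε : ℝ, 0 < ε → ∃ N, ∀ n ≥ N, ∀ x, |(T n : Module.End ℝ E) x - L x| ≤ ε • |x| := by
    intro ε hε
    obtain ⟨N, hN⟩ := Metric.cauchySeq_iff.mp hT ε hε
    refine ⟨N, fun n hn x => ?_⟩
    have h1 : Filter.Tendsto (fun m => |(T n : Module.End ℝ E) x - (T m : Module.End ℝ E) x|)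
        Filter.atTop (nhds |(T n : Module.End ℝ E) x - L x|) := by
      have h2 := tendsto_const_nhds (x := (T n : Module.End ℝ E) x) (f := Filter.atTop) |>.sub (hL x)
      exact h2.sup_nhds h2.neg
    refine le_of_tendsto h1 (Filter.eventually_atTop.mpr ⟨N, fun m hm => ?_⟩)
    exact (hsub n m x).trans (smul_le_smul_of_nonneg_right (hN n hn m hm).le (abs_nonneg x))
  let Llin : Module.End ℝ E :=
    { toFun := L
      map_add' := fun x y => tendsto_nhds_unique (hL (x + y)) (by
        simpa only [map_add] using (hL x).add (hL y))
      map_smul' := fun r x => tendsto_nhds_unique (hL (r • x)) (by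
        simpa only [map_smul, RingHom.id_apply] using (hL x).const_smul r) }
  have hmem : Llin ∈ Orth E := by
    obtain ⟨N, hN⟩ := hest 1 one_pos
    constructor
    · intro S hS x hx
      -- The difference is dominated by `|x|`, so it stays in every solid subspace containing `x`.
      have h1 : (T N : Module.End ℝ E) x - L x ∈ S := by
        refine hS.solid hx ?_
        simpa using hN N le_rfl x
      have h2 := S.sub_mem ((T N).2.1 S hS x hx) h1
      rwa [sub_sub_cancel] at h2
    · intro a b
      obtain ⟨c, d, h⟩ := (T N).2.2 a b
      refine ⟨c - (|a| ⊔ |b|), d + (|a| ⊔ |b|), fun x hx => ?_⟩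
      have h1 := h x hx
      have h2 : |x| ≤ |a| ⊔ |b| := abs_le'.mpr
        ⟨hx.2.trans ((le_abs_self b).trans le_sup_right),
          (neg_le_neg hx.1).trans ((neg_le_abs a).trans le_sup_left)⟩
      have h3 : |(T N : Module.End ℝ E) x - L x| ≤ |a| ⊔ |b| := by
        simpa using (hN N le_rfl x).trans (by simpa using h2)
      constructor
      · have h4 := (le_abs_self _).trans h3
        rw [sub_le_iff_le_add] at h4 ⊢
        exact h1.1.trans (by rw [add_comm]; exact h4)
      · have h4 := (neg_le_abs _).trans h3
        rw [neg_sub, sub_le_iff_le_add'] at h4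
        exact h4.trans (add_le_add_left h1.2 _)
  refine ⟨⟨Llin, hmem⟩, Metric.tendsto_atTop.mpr fun ε hε => ?_⟩
  obtain ⟨N, hN⟩ := hest (ε / 2) (by positivity)
  refine ⟨N, fun n hn => ?_⟩
  have h1 : orderUnitNorm 1 (T n - ⟨Llin, hmem⟩) ≤ ε / 2 := by
    refine orderUnitNorm_le (by positivity) fun x hx => ?_
    rw [Orth.abs_apply _ hx]
    have := hN n hn x
    rwa [abs_of_nonneg hx] at this
  calc dist (T n) ⟨Llin, hmem⟩ = orderUnitNorm 1 (T n - ⟨Llin, hmem⟩) := dist_eq_norm _ _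
    _ < ε := by linarith

end OrthBanach

section OrderUnit

variable {V : Type*} [AddCommGroup V] [Module ℝ V] [Lattice V] [IsArchimedeanVectorLattice V]

/-- The normed space structure given by an order unit. -/
noncomputable abbrev IsOrderUnit.normedSpace {e : V} (he : IsOrderUnit e) :
    letI := he.normedAddCommGroup
    NormedSpace ℝ V :=
  letI := he.normedAddCommGroup
  { (inferInstance : Module ℝ V) with
    norm_smul_le := fun r x => by
      refine orderUnitNorm_le (mul_nonneg (norm_nonneg _) (norm_nonneg _)) ?_
      rw [abs_smul_eq, mul_smul]
      exact smul_le_smul_of_nonneg_left (he.abs_le x) (abs_nonneg r) }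

end OrderUnit

/-! ### States and characters -/

section Characters

variable (A : Type*) [Ring A] [Algebra ℝ A] [Lattice A]

/-- The normalized positive functionals. -/
def positiveStates : Set (A → ℝ) :=
  {φ | φ 1 = 1 ∧ (∀ a b, φ (a + b) = φ a + φ b) ∧ (∀ (r : ℝ) a, φ (r • a) = r * φ a) ∧
    ∀ a, 0 ≤ a → 0 ≤ φ a}

/-- The unital multiplicative lattice homomorphisms to the reals. -/
def latticeCharacters : Set (A → ℝ) :=
  {φ | φ 1 = 1 ∧ (∀ a b, φ (a + b) = φ a + φ b) ∧ (∀ (r : ℝ) a, φ (r • a) = r * φ a) ∧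
    (∀ a b, φ (a * b) = φ a * φ b) ∧ ∀ a, φ |a| = |φ a|}

theorem isClosed_positiveStates : IsClosed (positiveStates A) := by
  have h : ∀ a : A, Continuous fun φ : A → ℝ => φ a := fun a => continuous_apply a
  simp only [positiveStates, Set.ofPred_and, Set.ofPred_forall]
  refine (isClosed_eq (h 1) continuous_const).inter (.inter ?_ (.inter ?_ ?_))
  · exact isClosed_iInter fun a => isClosed_iInter fun b => isClosed_eq (h _) ((h a).add (h b))
  · exact isClosed_iInter fun r => isClosed_iInter fun a =>
      isClosed_eq (h _) (continuous_const.mul (h a))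
  · exact isClosed_iInter fun a => isClosed_iInter fun _ => isClosed_le continuous_const (h a)

theorem isClosed_latticeCharacters : IsClosed (latticeCharacters A) := by
  have h : ∀ a : A, Continuous fun φ : A → ℝ => φ a := fun a => continuous_apply a
  simp only [latticeCharacters, Set.ofPred_and, Set.ofPred_forall]
  refine (isClosed_eq (h 1) continuous_const).inter (.inter ?_ (.inter ?_ (.inter ?_ ?_)))
  · exact isClosed_iInter fun a => isClosed_iInter fun b => isClosed_eq (h _) ((h a).add (h b))
  · exact isClosed_iInter fun r => isClosed_iInter fun a =>
      isClosed_eq (h _) (continuous_const.mul (h a))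
  · exact isClosed_iInter fun a => isClosed_iInter fun b => isClosed_eq (h _) ((h a).mul (h b))
  · exact isClosed_iInter fun a => isClosed_eq (h _) (h a).abs

variable {A}

theorem map_sub_of_mem_positiveStates {φ : A → ℝ} (hφ : φ ∈ positiveStates A) (a b : A) :
    φ (a - b) = φ a - φ b := by
  have h := hφ.2.1 (a - b) b
  rw [sub_add_cancel] at h
  linarith

variable [IsFAlgebra A]

theorem monotone_of_mem_positiveStates {φ : A → ℝ} (hφ : φ ∈ positiveStates A) : Monotone φ := by
  intro a b hab
  have h := hφ.2.2.2 _ (sub_nonneg.mpr hab)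
  rw [map_sub_of_mem_positiveStates hφ] at h
  linarith

theorem abs_le_of_mem_positiveStates {φ : A → ℝ} (hφ : φ ∈ positiveStates A) {a c : A}
    (h : |a| ≤ c) : |φ a| ≤ φ c := by
  have h1 := monotone_of_mem_positiveStates hφ ((le_abs_self a).trans h)
  have h2 := monotone_of_mem_positiveStates hφ ((neg_le_abs a).trans h)
  rw [← neg_one_smul ℝ a, hφ.2.2.1] at h2
  exact _root_.abs_le.mpr ⟨by linarith, h1⟩

theorem latticeCharacters_subset_positiveStates : latticeCharacters A ⊆ positiveStates A := by
  rintro φ ⟨h1, h2, h3, -, h5⟩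
  refine ⟨h1, h2, h3, fun a ha => ?_⟩
  rw [← abs_of_nonneg ha, h5]
  exact abs_nonneg _

theorem abs_apply_le_orderUnitNorm (hu : IsOrderUnit (1 : A)) {φ : A → ℝ}
    (hφ : φ ∈ positiveStates A) (a : A) : |φ a| ≤ orderUnitNorm 1 a := by
  have h := abs_le_of_mem_positiveStates hφ (hu.abs_le a)
  rwa [hφ.2.2.1, hφ.1, mul_one] at h

/-- Tychonoff: in the topology of pointwise convergence, states lie in a product of compact
intervals. -/
theorem isCompact_of_subset_positiveStates (hu : IsOrderUnit (1 : A)) {F : Set (A → ℝ)}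
    (hF : IsClosed F) (h : F ⊆ positiveStates A) : IsCompact F := by
  refine IsCompact.of_isClosed_subset (isCompact_univ_pi
    fun a : A => isCompact_Icc (a := -orderUnitNorm 1 a) (b := orderUnitNorm 1 a)) hF ?_
  exact fun φ hφ a _ => _root_.abs_le.mp (abs_apply_le_orderUnitNorm hu (h hφ) a)

/-- `|c * a|` is dominated by a multiple of `c`. This settles the cases in which `φ (c * ·)` or `φ
((1 - c) * ·)` cannot be normalized. -/
theorem apply_mul_eq_zero_of_mem_positiveStates (hu : IsOrderUnit (1 : A)) {φ : A → ℝ}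
    (hφ : φ ∈ positiveStates A) {c : A} (hc : 0 ≤ c) (h0 : φ c = 0) (a : A) : φ (c * a) = 0 := by
  have h1 : |c * a| ≤ orderUnitNorm 1 a • c := by
    have h2 := abs_le'.mp (hu.abs_le a)
    refine abs_le'.mpr ⟨?_, ?_⟩
    · simpa using IsFAlgebra.mul_le_mul_left h2.1 hc
    · simpa using IsFAlgebra.mul_le_mul_left h2.2 hc
  have h3 := abs_le_of_mem_positiveStates hφ h1
  rw [hφ.2.2.1, h0, mul_zero] at h3
  exact abs_nonpos_iff.mp h3

theorem apply_mul_of_mem_extremePoints_of_le_one (hu : IsOrderUnit (1 : A)) {φ : A → ℝ}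
    (hφ : φ ∈ (positiveStates A).extremePoints ℝ) {c : A} (hc : 0 ≤ c) (hc1 : c ≤ 1) (a : A) :
    φ (c * a) = φ c * φ a := by
  have hs : φ ∈ positiveStates A := hφ.1
  have hd : 0 ≤ 1 - c := sub_nonneg.mpr hc1
  have hsub : ∀ b, φ ((1 - c) * b) = φ b - φ (c * b) := fun b => by
    rw [sub_mul, one_mul, map_sub_of_mem_positiveStates hs]
  have hsub1 : φ (1 - c) = 1 - φ c := by rw [map_sub_of_mem_positiveStates hs, hs.1]
  have h0 := hs.2.2.2 c hc
  have h1 := hs.2.2.2 _ hd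
  rw [hsub1] at h1
  rcases h0.eq_or_lt with h0 | h0
  · rw [← h0, zero_mul]
    exact apply_mul_eq_zero_of_mem_positiveStates hu hs hc h0.symm a
  rcases h1.eq_or_lt with h1 | h1
  · have h2 := apply_mul_eq_zero_of_mem_positiveStates hu hs hd (by rw [hsub1, ← h1]) a
    rw [hsub] at h2
    have : φ c = 1 := by linarith
    rw [this]; linarith
  have key : ∀ d : A, 0 ≤ d → 0 < φ d → (fun b => (φ d)⁻¹ * φ (d * b)) ∈ positiveStates A := by
    intro d hd hφd
    refine ⟨?_, fun x y => ?_, fun r x => ?_, fun x hx => ?_⟩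
    · simp [hφd.ne']
    · simp only [mul_add, hs.2.1]
    · simp only [mul_smul_comm, hs.2.2.1]; ring
    · exact mul_nonneg (by positivity) (hs.2.2.2 _ (IsFAlgebra.mul_nonneg _ _ hd hx))
  -- `φ` is the convex combination, with weights `φ c` and `1 - φ c`, of two states, and so equals
  -- the first.
  have hext := hφ.2 (key c hc h0) (key (1 - c) hd (by rw [hsub1]; exact h1))
    ⟨φ c, 1 - φ c, h0, h1, by ring, by
      funext b
      simp only [Pi.add_apply, Pi.smul_apply, smul_eq_mul, hsub, hsub1]
      field_simp
      ring⟩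
  have h3 := congrFun hext a
  change (φ c)⁻¹ * φ (c * a) = φ a at h3
  rw [← h3]
  field_simp

theorem extremePoints_positiveStates_subset (hu : IsOrderUnit (1 : A)) :
    (positiveStates A).extremePoints ℝ ⊆ latticeCharacters A := by
  intro φ hφ
  have hs : φ ∈ positiveStates A := hφ.1
  have hpos : ∀ c a : A, 0 ≤ c → φ (c * a) = φ c * φ a := by
    intro c a hc
    set s := orderUnitNorm 1 c + 1 with hsdef
    have hs0 : 0 < s := by have := orderUnitNorm_nonneg 1 c; positivity
    have h1 : s⁻¹ • c ≤ 1 := by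
      calc s⁻¹ • c ≤ s⁻¹ • (s • (1 : A)) := by
            refine smul_le_smul_of_nonneg_left ?_ (by positivity)
            exact ((le_abs_self c).trans (hu.abs_le c)).trans
              (smul_le_smul_of_nonneg_right (by linarith) hu.1)
        _ = 1 := by rw [smul_smul, inv_mul_cancel₀ hs0.ne', one_smul]
    have h2 := apply_mul_of_mem_extremePoints_of_le_one hu hφ
      (smul_nonneg (by positivity : 0 ≤ s⁻¹) hc) h1 a
    rw [smul_mul_assoc, hs.2.2.1, hs.2.2.1, mul_assoc] at h2
    exact mul_left_cancel₀ (by positivity) h2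
  have hmul : ∀ a b : A, φ (a * b) = φ a * φ b := by
    intro a b
    calc φ (a * b) = φ (a⁺ * b - a⁻ * b) := by rw [← sub_mul, posPart_sub_negPart]
      _ = φ (a⁺ - a⁻) * φ b := by
        rw [map_sub_of_mem_positiveStates hs, map_sub_of_mem_positiveStates hs,
          hpos _ _ (posPart_nonneg a), hpos _ _ (negPart_nonneg a), sub_mul]
      _ = φ a * φ b := by rw [posPart_sub_negPart]
  refine ⟨hs.1, hs.2.1, hs.2.2.1, hmul, fun a => ?_⟩
  rw [← abs_of_nonneg (hs.2.2.2 _ (abs_nonneg a)), abs_eq_iff_mul_self_eq, ← hmul, ← hmul,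
    abs_mul_abs_eq_mul_self]

/-- With `l` the norm of `a`, Hahn–Banach is applied at `a + l • 1`, whose norm is at least `2 * l`.
As `g a ≤ l` and `g 1 ≤ 1`, both must be equalities. A functional of norm at most `1` with `g 1 = 1`
is positive, because `‖x‖ • 1 - x` has norm at most `‖x‖` for `x ≥ 0`. -/
theorem exists_mem_positiveStates_apply_eq (hu : IsOrderUnit (1 : A)) {a : A} (ha : 0 ≤ a)
    (ha' : 0 < orderUnitNorm 1 a) : ∃ φ ∈ positiveStates A, φ a = orderUnitNorm 1 a := by
  let := hu.normedAddCommGroup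
  let := hu.normedSpace
  set l := orderUnitNorm 1 a with hl
  have hone : ‖(1 : A)‖ ≤ 1 := orderUnitNorm_le zero_le_one (by
    rw [one_smul, abs_of_nonneg hu.1])
  have hsum : 2 * l ≤ ‖a + l • (1 : A)‖ := by
    set r := ‖a + l • (1 : A)‖ with hr
    have h1 : a + l • (1 : A) ≤ r • 1 := (le_abs_self _).trans (hu.abs_le _)
    have h2 : a ≤ (r - l) • (1 : A) := by rw [sub_smul]; exact le_sub_iff_add_le.mpr h1
    rcases le_total 0 (r - l) with h | h
    · have := orderUnitNorm_le h ((abs_of_nonneg ha).trans_le h2)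
      linarith
    · have h3 : a ≤ 0 := h2.trans (smul_nonpos_of_nonpos_of_nonneg h hu.1)
      have h4 : a = 0 := le_antisymm h3 ha
      have h5 : l = 0 := by rw [hl, h4]; exact norm_zero (E := A)
      linarith
  obtain ⟨g, hg1, hg⟩ := exists_dual_vector'' ℝ (a + l • (1 : A))
  have hgle : ∀ x : A, g x ≤ ‖x‖ := fun x => by
    have := g.le_of_opNorm_le hg1 x
    rw [one_mul] at this
    exact (le_abs_self _).trans this
  have hg' : g a + l * g 1 = ‖a + l • (1 : A)‖ := by
    have h : g (a + l • (1 : A)) = g a + l * g 1 := by rw [map_add, map_smul, smul_eq_mul]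
    rw [← h, hg]; rfl
  have hga : g a ≤ l := hgle a
  have hg11 : g 1 ≤ 1 := (hgle 1).trans hone
  have hgone : g 1 = 1 := by
    refine le_antisymm hg11 ?_
    by_contra! hlt
    nlinarith
  refine ⟨g, ⟨hgone, map_add g, fun r x => by rw [map_smul, smul_eq_mul], fun x hx => ?_⟩, ?_⟩
  · rcases (norm_nonneg x).eq_or_lt with h0 | h0
    · rw [norm_eq_zero.mp h0.symm, map_zero]
    have h1 : ‖‖x‖ • (1 : A) - x‖ ≤ ‖x‖ := by
      refine orderUnitNorm_le (norm_nonneg _) ?_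
      have h2 : x ≤ ‖x‖ • (1 : A) := (le_abs_self x).trans (hu.abs_le x)
      rw [abs_of_nonneg (sub_nonneg.mpr h2)]
      exact sub_le_self _ hx
    have h3 := (hgle _).trans h1
    rw [map_sub, map_smul, hgone, smul_eq_mul, mul_one] at h3
    linarith
  · rw [hgone] at hg'
    linarith

/-- The characters of an f-algebra with order unit `1` are norming. -/
theorem exists_latticeCharacter_abs_apply_eq (hu : IsOrderUnit (1 : A)) {a : A}
    (ha : 0 < orderUnitNorm 1 a) : ∃ φ ∈ latticeCharacters A, |φ a| = orderUnitNorm 1 a := by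
  have habs : orderUnitNorm 1 |a| = orderUnitNorm 1 a := by simp [orderUnitNorm]
  -- A face of the states, being the set where evaluation at `|a|` is maximal; hence its extreme
  -- points are extreme states.
  let F : Set (A → ℝ) := {φ | φ ∈ positiveStates A ∧ φ |a| = orderUnitNorm 1 a}
  have hF : IsClosed F := (isClosed_positiveStates A).inter
    (isClosed_eq (continuous_apply |a|) continuous_const)
  have hFc : IsCompact F := isCompact_of_subset_positiveStates hu hF fun φ hφ => hφ.1
  obtain ⟨φ₀, h₀, h₀'⟩ := exists_mem_positiveStates_apply_eq hu (abs_nonneg a) (habs.symm ▸ ha)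
  obtain ⟨φ, hφ⟩ := hFc.extremePoints_nonempty ⟨φ₀, h₀, h₀'.trans habs⟩
  have hext : IsExtreme ℝ (positiveStates A) F := by
    refine ⟨fun φ hφ => hφ.1, fun x hx y hy z hz hzxy => ⟨hx, ?_⟩⟩
    obtain ⟨s, t, hs, ht, hst, rfl⟩ := hzxy
    have h1 := (le_abs_self _).trans (abs_apply_le_orderUnitNorm hu hx |a|)
    have h2 := (le_abs_self _).trans (abs_apply_le_orderUnitNorm hu hy |a|)
    have h3 := hz.2
    simp only [Pi.add_apply, Pi.smul_apply, smul_eq_mul] at h3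
    rw [habs] at h1 h2
    refine le_antisymm h1 ?_
    have ht' : t = 1 - s := by linarith
    subst ht'
    by_contra! hlt
    nlinarith
  have hc := extremePoints_positiveStates_subset hu (hext.extremePoints_subset_extremePoints hφ)
  exact ⟨φ, hc, by rw [← hc.2.2.2.2 a]; exact hφ.1.2⟩

theorem orderUnitNorm_le_iff_forall_latticeCharacters (hu : IsOrderUnit (1 : A)) {a : A} {r : ℝ}
    (hr : 0 ≤ r) : orderUnitNorm 1 a ≤ r ↔ ∀ φ ∈ latticeCharacters A, |φ a| ≤ r := by
  refine ⟨fun h φ hφ => (abs_apply_le_orderUnitNorm hu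
    (latticeCharacters_subset_positiveStates hφ) a).trans h, fun h => ?_⟩
  rcases (orderUnitNorm_nonneg 1 a).eq_or_lt with h0 | h0
  · rwa [← h0]
  · obtain ⟨φ, hφ, hφa⟩ := exists_latticeCharacter_abs_apply_eq hu h0
    exact hφa ▸ h φ hφ

end Characters

/-! ### Closed subalgebras and their representation -/

section ClosedSubalgebras

/-- The factor `a` removes the constant term, which a non-unital subalgebra need not contain. -/
theorem mul_aeval_mem {A : Type*} [Ring A] [Algebra ℝ A] (C : NonUnitalSubalgebra ℝ A) {a : A} (ha : a ∈ C) (p : Polynomial ℝ) :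
    a * Polynomial.aeval a p ∈ C := by
  induction p using Polynomial.induction_on' with
  | add p q hp hq => rw [map_add, mul_add]; exact C.add_mem hp hq
  | monomial n r =>
    rw [Polynomial.aeval_monomial, ← Algebra.smul_def, mul_smul_comm, ← pow_succ']
    refine C.smul_mem r ?_
    induction n with
    | zero => simpa using ha
    | succ n ih => rw [pow_succ]; exact C.mul_mem ih ha

variable {A : Type*} [Ring A] [Algebra ℝ A] [Lattice A]

/-- A lattice character, as a homomorphism of algebras. -/
def latticeCharacterHom {φ : A → ℝ} (hφ : φ ∈ latticeCharacters A) : A →ₐ[ℝ] ℝ :=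
  AlgHom.ofLinearMap ⟨⟨φ, hφ.2.1⟩, hφ.2.2.1⟩ hφ.1 hφ.2.2.2.1

variable [IsFAlgebra A]

theorem orderUnitNorm_mul_le (hu : IsOrderUnit (1 : A)) (a b : A) :
    orderUnitNorm 1 (a * b) ≤ orderUnitNorm 1 a * orderUnitNorm 1 b := by
  rw [orderUnitNorm_le_iff_forall_latticeCharacters hu
    (mul_nonneg (orderUnitNorm_nonneg _ _) (orderUnitNorm_nonneg _ _))]
  intro φ hφ
  have h := fun a => abs_apply_le_orderUnitNorm hu (latticeCharacters_subset_positiveStates hφ) a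
  rw [hφ.2.2.2.1, abs_mul]
  exact mul_le_mul (h a) (h b) (abs_nonneg _) (orderUnitNorm_nonneg _ _)

/-- The normed ring structure of an f-algebra whose identity is an order unit. -/
noncomputable abbrev IsOrderUnit.normedRing (hu : IsOrderUnit (1 : A)) : NormedRing A :=
  RingNorm.toNormedRing
    { toFun := orderUnitNorm 1
      map_zero' := @norm_zero A hu.normedAddCommGroup.toSeminormedAddCommGroup.toSeminormedAddGroup
      add_le' := @norm_add_le A hu.normedAddCommGroup.toSeminormedAddCommGroup.toSeminormedAddGroup
      neg' := @norm_neg A hu.normedAddCommGroup.toSeminormedAddCommGroup.toSeminormedAddGroup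
      mul_le' := orderUnitNorm_mul_le hu
      eq_zero_of_map_eq_zero' := fun _ h => hu.eq_zero h }

theorem exists_nonUnitalSubalgebra_eq_closure (hu : IsOrderUnit (1 : A))
    (B : NonUnitalSubalgebra ℝ A) :
    letI := hu.normedAddCommGroup
    ∃ C : NonUnitalSubalgebra ℝ A, (C : Set A) = closure (B : Set A) := by
  let := hu.normedRing
  let : NormedSpace ℝ A := hu.normedSpace
  exact ⟨B.topologicalClosure, rfl⟩

/-- Closed subalgebras are closed under absolute values. -/
theorem abs_mem_of_isClosed (hu : IsOrderUnit (1 : A)) {C : NonUnitalSubalgebra ℝ A}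
    (hC : letI := hu.normedAddCommGroup; IsClosed (C : Set A)) {a : A} (ha : a ∈ C) : |a| ∈ C := by
  let := hu.normedAddCommGroup
  change |a| ∈ (C : Set A)
  rw [← hC.closure_eq, Metric.mem_closure_iff]
  intro ε hε
  set M := orderUnitNorm 1 a with hM
  have hM0 : 0 ≤ M := orderUnitNorm_nonneg 1 a
  -- Weierstrass approximation of `|t|`. Passing to `X * p.divX` drops the constant term `p(0)`,
  -- itself below `ε / 4` since `|0| = 0`; the total error is at most `ε / 2`.
  obtain ⟨p, hp⟩ := exists_polynomial_near_of_continuousOn (-M) M (fun t => |t|)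
    continuous_abs.continuousOn (ε / 4) (by positivity)
  refine ⟨a * Polynomial.aeval a p.divX, mul_aeval_mem C ha _, ?_⟩
  have h1 : orderUnitNorm 1 (|a| - a * Polynomial.aeval a p.divX) ≤ ε / 2 := by
    rw [orderUnitNorm_le_iff_forall_latticeCharacters hu (by positivity)]
    intro φ hφ
    have hφa := _root_.abs_le.mp
      (abs_apply_le_orderUnitNorm hu (latticeCharacters_subset_positiveStates hφ) a)
    have h2 : φ (Polynomial.aeval a p.divX) = p.divX.eval (φ a) := by
      have := Polynomial.aeval_algHom_apply (latticeCharacterHom hφ) a p.divX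
      rw [Polynomial.aeval_def, Polynomial.eval₂_eq_eval_map] at this
      simpa [latticeCharacterHom] using this.symm
    have h3 : p.eval (φ a) = φ a * p.divX.eval (φ a) + p.coeff 0 := by
      conv_lhs => rw [← Polynomial.divX_mul_X_add p]
      rw [Polynomial.eval_add, Polynomial.eval_mul, Polynomial.eval_X, Polynomial.eval_C, mul_comm]
    have h4 := hp (φ a) ⟨hφa.1, hφa.2⟩
    have h5 := hp 0 ⟨by linarith, hM0⟩
    rw [← Polynomial.coeff_zero_eq_eval_zero, abs_zero, sub_zero] at h5
    rw [map_sub_of_mem_positiveStates (latticeCharacters_subset_positiveStates hφ),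
      hφ.2.2.2.1, hφ.2.2.2.2, h2]
    rw [abs_lt] at h4 h5
    rw [_root_.abs_le]
    constructor <;> linarith
  calc dist |a| (a * Polynomial.aeval a p.divX)
      = orderUnitNorm 1 (|a| - a * Polynomial.aeval a p.divX) := dist_eq_norm _ _
    _ < ε := by linarith

theorem isBanachFSubalgebra_of_isClosed (hu : IsOrderUnit (1 : A)) {C : NonUnitalSubalgebra ℝ A}
    (hA : letI := hu.normedAddCommGroup; CompleteSpace A)
    (hC : letI := hu.normedAddCommGroup; IsClosed (C : Set A)) : IsBanachFSubalgebra hu C where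
  sup_mem a ha b hb := by
    rw [← half_smul_add_add_abs_sub]
    exact C.smul_mem _ (C.add_mem (C.add_mem ha hb) (abs_mem_of_isClosed hu hC (sub_mem ha hb)))
  inf_mem a ha b hb := by
    rw [← half_smul_add_sub_abs_sub]
    exact C.smul_mem _ (sub_mem (C.add_mem ha hb) (abs_mem_of_isClosed hu hC (sub_mem ha hb)))
  norm_solid a _ b _ h := orderUnitNorm_le (orderUnitNorm_nonneg _ _) (h.trans (hu.abs_le b))
  norm_mul_le a _ b _ := orderUnitNorm_mul_le hu a b
  complete := by
    let := hu.normedAddCommGroup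
    exact hC.isComplete

/-- The restrictions of the lattice characters to a subalgebra. -/
def restrictedCharacters (C : NonUnitalSubalgebra ℝ A) : Set (C → ℝ) :=
  (fun (φ : A → ℝ) (c : C) => φ c) '' latticeCharacters A

theorem isCompact_restrictedCharacters (hu : IsOrderUnit (1 : A)) (C : NonUnitalSubalgebra ℝ A) :
    IsCompact (restrictedCharacters C) :=
  (isCompact_of_subset_positiveStates hu (isClosed_latticeCharacters A)
    latticeCharacters_subset_positiveStates).image
      (continuous_pi fun c => continuous_apply (c : A))

/-- Evaluation of the elements of a subalgebra at the characters. -/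
def evaluationHom (C : NonUnitalSubalgebra ℝ A) : C →ₙₐ[ℝ] C(restrictedCharacters C, ℝ) where
  toFun c := ⟨fun k => k.1 c, (continuous_apply c).comp continuous_subtype_val⟩
  map_smul' r c := by
    ext ⟨_, φ, hφ, rfl⟩
    exact hφ.2.2.1 r c
  map_zero' := by
    ext ⟨_, φ, hφ, rfl⟩
    exact map_zero (latticeCharacterHom hφ)
  map_add' a b := by
    ext ⟨_, φ, hφ, rfl⟩
    exact hφ.2.1 a b
  map_mul' a b := by
    ext ⟨_, φ, hφ, rfl⟩
    exact hφ.2.2.2.1 a b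

theorem norm_evaluationHom (hu : IsOrderUnit (1 : A)) (C : NonUnitalSubalgebra ℝ A)
    [CompactSpace (restrictedCharacters C)] (a : C) :
    ‖evaluationHom C a‖ = orderUnitNorm 1 (a : A) := by
  refine le_antisymm ?_ ?_
  · rw [ContinuousMap.norm_le _ (orderUnitNorm_nonneg _ _)]
    rintro ⟨_, φ, hφ, rfl⟩
    exact abs_apply_le_orderUnitNorm hu (latticeCharacters_subset_positiveStates hφ) a
  · rw [orderUnitNorm_le_iff_forall_latticeCharacters hu (norm_nonneg _)]
    intro φ hφ
    exact (evaluationHom C a).norm_coe_le_norm ⟨_, φ, hφ, rfl⟩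

theorem map_sup_of_mem_latticeCharacters {φ : A → ℝ} (hφ : φ ∈ latticeCharacters A) (a b : A) :
    φ (a ⊔ b) = φ a ⊔ φ b := by
  rw [← half_smul_add_add_abs_sub, ← half_smul_add_add_abs_sub, hφ.2.2.1, hφ.2.1, hφ.2.1,
    hφ.2.2.2.2, map_sub_of_mem_positiveStates (latticeCharacters_subset_positiveStates hφ),
    smul_eq_mul]

theorem map_inf_of_mem_latticeCharacters {φ : A → ℝ} (hφ : φ ∈ latticeCharacters A) (a b : A) :
    φ (a ⊓ b) = φ a ⊓ φ b := by
  have hs := latticeCharacters_subset_positiveStates hφ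
  rw [← half_smul_add_sub_abs_sub, ← half_smul_add_sub_abs_sub, hφ.2.2.1,
    map_sub_of_mem_positiveStates hs, hφ.2.1, hφ.2.2.2.2, map_sub_of_mem_positiveStates hs,
    smul_eq_mul]

theorem evaluationHom_injective (hu : IsOrderUnit (1 : A)) (C : NonUnitalSubalgebra ℝ A) :
    Function.Injective (evaluationHom C) := by
  have := isCompact_iff_compactSpace.mp (isCompact_restrictedCharacters hu C)
  rw [injective_iff_map_eq_zero]
  intro a ha
  have h := norm_evaluationHom hu C a
  rw [ha, norm_zero] at h
  exact Subtype.ext (hu.eq_zero h.symm)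

/-- The range is closed, as an isometric image of a complete space, and contains the constants since
`1 ∈ C`. Stone–Weierstrass makes it everything. -/
theorem evaluationHom_surjective (hu : IsOrderUnit (1 : A)) {C : NonUnitalSubalgebra ℝ A}
    (hC : letI := hu.normedAddCommGroup; IsComplete (C : Set A)) (h1 : (1 : A) ∈ C) :
    Function.Surjective (evaluationHom C) := by
  have := isCompact_iff_compactSpace.mp (isCompact_restrictedCharacters hu C)
  let S : Subalgebra ℝ C(restrictedCharacters C, ℝ) :=
    { carrier := Set.range (evaluationHom C)
      mul_mem' := by
        rintro _ _ ⟨a, rfl⟩ ⟨b, rfl⟩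
        exact ⟨a * b, map_mul _ a b⟩
      add_mem' := by
        rintro _ _ ⟨a, rfl⟩ ⟨b, rfl⟩
        exact ⟨a + b, map_add _ a b⟩
      algebraMap_mem' := fun r => by
        refine ⟨r • ⟨1, h1⟩, ?_⟩
        ext ⟨_, φ, hφ, rfl⟩
        change φ (r • (1 : A)) = r
        rw [hφ.2.2.1, hφ.1, mul_one] }
  have hclosed : IsClosed (S : Set C(restrictedCharacters C, ℝ)) := by
    let := hu.normedAddCommGroup
    have hcomp : CompleteSpace (C : Set A) := hC.completeSpace_coe
    have hiso : Isometry (fun c : (C : Set A) => evaluationHom C c) := by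
      refine Isometry.of_dist_eq fun a b => ?_
      have h := norm_evaluationHom hu C ((a : C) - (b : C))
      rw [map_sub] at h
      rw [dist_eq_norm, h]
      exact (dist_eq_norm (a : A) (b : A)).symm
    exact hiso.isClosedEmbedding.isClosed_range
  -- Points of the spectrum are functions on `C`, so distinct ones differ at an element of `C`.
  have hsep : S.SeparatesPoints := by
    intro k k' hk
    obtain ⟨c, hc⟩ := Function.ne_iff.mp fun h => hk (Subtype.ext h)
    exact ⟨_, ⟨_, ⟨c, rfl⟩, rfl⟩, hc⟩
  have htop := ContinuousMap.subalgebra_topologicalClosure_eq_top_of_separatesPoints S hsep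
  intro f
  have hf : f ∈ S.topologicalClosure := htop ▸ Algebra.mem_top
  have hf' : f ∈ closure (S : Set C(restrictedCharacters C, ℝ)) := hf
  rw [hclosed.closure_eq] at hf'
  exact hf'

theorem isIsometricallyContinuousFunctions_restrictedCharacters (hu : IsOrderUnit (1 : A))
    {C : NonUnitalSubalgebra ℝ A} [CompactSpace (restrictedCharacters C)]
    (hC : letI := hu.normedAddCommGroup; IsComplete (C : Set A)) (h1 : (1 : A) ∈ C) :
    IsIsometricallyContinuousFunctions C (restrictedCharacters C) := by
  refine ⟨evaluationHom C, ⟨evaluationHom_injective hu C, evaluationHom_surjective hu hC h1⟩,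
    fun a b c hc => ?_, fun a b c hc => ?_, norm_evaluationHom hu C⟩
  · ext ⟨_, φ, hφ, rfl⟩
    change φ c = φ a ⊔ φ b
    rw [hc, map_sup_of_mem_latticeCharacters hφ]
  · ext ⟨_, φ, hφ, rfl⟩
    change φ c = φ a ⊓ φ b
    rw [hc, map_inf_of_mem_latticeCharacters hφ]

end ClosedSubalgebras

/-! ### Uniqueness of the compact space -/

section Uniqueness

/-- The Banach–Stone theorem for algebra isomorphisms. -/
theorem nonempty_homeomorph_of_algEquiv {K L : Type*} [TopologicalSpace K] [CompactSpace K]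
    [T2Space K] [TopologicalSpace L] [CompactSpace L] [T2Space L] (e : C(K, ℝ) ≃ₐ[ℝ] C(L, ℝ)) :
    Nonempty (K ≃ₜ L) := by
  -- The star operation is trivial over `ℝ`, so the functoriality of character spaces applies.
  let f : C(K, ℝ) →⋆ₐ[ℝ] C(L, ℝ) := { e.toAlgHom with map_star' := fun x => by simp }
  let g : C(L, ℝ) →⋆ₐ[ℝ] C(K, ℝ) := { e.symm.toAlgHom with map_star' := fun x => by simp }
  have hfg : f.comp g = StarAlgHom.id ℝ _ := StarAlgHom.ext e.apply_symm_apply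
  have hgf : g.comp f = StarAlgHom.id ℝ _ := StarAlgHom.ext e.symm_apply_apply
  have h1 := WeakDual.CharacterSpace.compContinuousMap_comp f g
  have h2 := WeakDual.CharacterSpace.compContinuousMap_comp g f
  rw [hfg, WeakDual.CharacterSpace.compContinuousMap_id] at h1
  rw [hgf, WeakDual.CharacterSpace.compContinuousMap_id] at h2
  let h : WeakDual.characterSpace ℝ C(K, ℝ) ≃ₜ WeakDual.characterSpace ℝ C(L, ℝ) :=
    { toFun := WeakDual.CharacterSpace.compContinuousMap g
      invFun := WeakDual.CharacterSpace.compContinuousMap f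
      left_inv := fun x => (DFunLike.congr_fun h2 x).symm
      right_inv := fun x => (DFunLike.congr_fun h1 x).symm
      continuous_toFun := map_continuous _
      continuous_invFun := map_continuous _ }
  exact ⟨((WeakDual.CharacterSpace.homeoEval K ℝ).trans h).trans
    (WeakDual.CharacterSpace.homeoEval L ℝ).symm⟩

theorem IsIsometricallyContinuousFunctions.nonempty_homeomorph {A : Type*} [Ring A] [Algebra ℝ A]
    [Lattice A] {C : NonUnitalSubalgebra ℝ A} {K L : Type*} [TopologicalSpace K] [CompactSpace K]
    [T2Space K] [TopologicalSpace L] [CompactSpace L] [T2Space L]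
    (hK : IsIsometricallyContinuousFunctions C K) (hL : IsIsometricallyContinuousFunctions C L) :
    Nonempty (K ≃ₜ L) := by
  obtain ⟨f, hf, -⟩ := hK
  obtain ⟨g, hg, -⟩ := hL
  let e : C(K, ℝ) ≃+* C(L, ℝ) :=
    (RingEquiv.ofBijective f hf).symm.trans (RingEquiv.ofBijective g hg)
  have he : ∀ c, e (f c) = g c := fun c =>
    congrArg g ((RingEquiv.ofBijective f hf).symm_apply_apply c)
  refine nonempty_homeomorph_of_algEquiv (AlgEquiv.ofRingEquiv (f := e) fun r => ?_)
  -- Real scalars are preserved because `r • 1` is the image of `r • c` under `f`, with `f c = 1`.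
  obtain ⟨c, hc⟩ := hf.2 1
  rw [Algebra.algebraMap_eq_smul_one, ← hc, ← map_smul, he, map_smul, ← he, hc, map_one,
    Algebra.algebraMap_eq_smul_one]

end Uniqueness

/-! ### The main theorem -/

theorem closure_isBanachFSubalgebra (A : Type u) [Ring A] [Algebra ℝ A] [Lattice A] [IsFAlgebra A]
    (hu : IsOrderUnit (1 : A)) :
    letI := hu.normedAddCommGroup
    CompleteSpace A →
    ∀ B : NonUnitalSubalgebra ℝ A, ∃ C : NonUnitalSubalgebra ℝ A,
      (C : Set A) = closure (B : Set A) ∧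
      IsBanachFSubalgebra hu C ∧
      ((1 : A) ∈ C →
        ∃ (K : Type u) (_ : TopologicalSpace K) (_ : CompactSpace K) (_ : T2Space K),
          IsIsometricallyContinuousFunctions C K ∧
          ∀ (L : Type v) [TopologicalSpace L] [CompactSpace L] [T2Space L],
            IsIsometricallyContinuousFunctions C L → Nonempty (K ≃ₜ L)) := by
  let := hu.normedAddCommGroup
  intro hA B
  obtain ⟨C, hC⟩ := exists_nonUnitalSubalgebra_eq_closure hu B
  have hB : IsBanachFSubalgebra hu C :=
    isBanachFSubalgebra_of_isClosed hu hA (hC ▸ isClosed_closure)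
  have hK : CompactSpace (restrictedCharacters C) :=
    isCompact_iff_compactSpace.mp (isCompact_restrictedCharacters hu C)
  refine ⟨C, hC, hB, fun h1 => ⟨restrictedCharacters C, inferInstance, hK, inferInstance, ?_, ?_⟩⟩
  · exact isIsometricallyContinuousFunctions_restrictedCharacters hu hB.complete h1
  · intro L _ _ _ hL
    exact (isIsometricallyContinuousFunctions_restrictedCharacters hu hB.complete
      h1).nonempty_homeomorph hL

theorem mainTheorem11 :
    -- the general result
    (∀ (A : Type u) [Ring A] [Algebra ℝ A] [Lattice A] [IsFAlgebra A]
        (hu : IsOrderUnit (1 : A)),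
      letI := hu.normedAddCommGroup
      CompleteSpace A →
      ∀ B : NonUnitalSubalgebra ℝ A, ∃ C : NonUnitalSubalgebra ℝ A,
        (C : Set A) = closure (B : Set A) ∧
        IsBanachFSubalgebra hu C ∧
        ((1 : A) ∈ C →
          ∃ (K : Type u) (_ : TopologicalSpace K) (_ : CompactSpace K) (_ : T2Space K),
            IsIsometricallyContinuousFunctions C K ∧
            ∀ (L : Type v) [TopologicalSpace L] [CompactSpace L] [T2Space L],
              IsIsometricallyContinuousFunctions C L → Nonempty (K ≃ₜ L))) ∧
    -- it applies to the orthomorphisms of a Banach lattice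
    (∀ (E : Type w) [NormedAddCommGroup E] [NormedSpace ℝ E] [CompleteSpace E] [Lattice E]
        [IsOrderedAddMonoid E] [IsOrderedModule ℝ E] [HasSolidNorm E],
      ∃ _ : Lattice (Orth E),
        (∀ S T : Orth E, S ≤ T ↔
          ∀ x : E, 0 ≤ x → (S : Module.End ℝ E) x ≤ (T : Module.End ℝ E) x) ∧
        ∃ (_ : IsFAlgebra (Orth E)) (hu : IsOrderUnit (1 : Orth E)),
          letI := hu.normedAddCommGroup
          CompleteSpace (Orth E) ∧
          (∀ T : Orth E, ∃ T' : E →L[ℝ] E, (∀ x : E, T' x = (T : Module.End ℝ E) x) ∧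
            ‖T'‖ = orderUnitNorm 1 T) ∧
          ∀ B : NonUnitalSubalgebra ℝ (Orth E), ∃ C : NonUnitalSubalgebra ℝ (Orth E),
            (C : Set (Orth E)) = closure (B : Set (Orth E)) ∧
            IsBanachFSubalgebra hu C ∧
            ((1 : Orth E) ∈ C →
              ∃ (K : Type w) (_ : TopologicalSpace K) (_ : CompactSpace K) (_ : T2Space K),
                IsIsometricallyContinuousFunctions C K ∧
                ∀ (L : Type v) [TopologicalSpace L] [CompactSpace L] [T2Space L],
                  IsIsometricallyContinuousFunctions C L → Nonempty (K ≃ₜ L))) := by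
  refine ⟨fun A _ _ _ _ hu => closure_isBanachFSubalgebra.{u, v} A hu, ?_⟩
  intro E _ _ _ _ _ _ _
  have : IsArchimedeanVectorLattice E := HasSolidNorm.isArchimedeanVectorLattice
  let := Orth.lattice (E := E)
  have := Orth.isFAlgebra (E := E)
  have hu := Orth.isOrderUnit_one (E := E)
  exact ⟨Orth.lattice, fun S T => Orth.le_iff, Orth.isFAlgebra, hu, Orth.completeSpace hu,
    Orth.exists_continuousLinearMap,
    closure_isBanachFSubalgebra.{w, v} (Orth E) hu (Orth.completeSpace hu)⟩
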